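/- Let $M$ be a connected smooth $2$-manifold (Hausdorff, second countable) with $H^2_{\mathrm{dR}}(M)=0$, let $T^1M$ be its tangent bundle and let $T^2M$ be the manifold of $2$-jets at $0$ of curves in $M$. A chart $(x,y)$ of $M$ induces charts $(t,x,y,\dot x,\dot y)$ on $\mathbb R\times T^1M$ and $(t,x,y,\dot x,\dot y,\ddot x,\ddot y)$ on $\mathbb R\times T^2M$. Let $\varepsilon$ be a smooth source form on $\mathbb R\times T^2M$, that is, a $2$-form which in each chart reads $\varepsilon=(\varepsilon_x\omega^x+\varepsilon_y\omega^y)\wedge dt$, where $\omega^x=dx-\dot x\,dt$, $\omega^y=dy-\dot y\,dt$, and suppose that $\varepsilon_x,\varepsilon_y$ do not depend explicitly on $t$. Suppose that $\varepsilon$ is locally variational: each point of $\mathbb R\times M$ has a chart neighbourhood over which there is a smooth function $\mathscr L(t,x,y,\dot x,\dot y)$ with $$\varepsilon_x=\frac{\partial\mathscr L}{\partial x}-\frac{d}{dt}\frac{\partial\mathscr L}{\partial\dot x},\qquad \varepsilon_y=\frac{\partial\mathscr L}{\partial y}-\frac{d}{dt}\frac{\partial\mathscr L}{\partial\dot y}.$$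 Then $\varepsilon$ is globally variational: there is a first-order Lagrangian $\mathscr L\,dt$ with $\mathscr L$ a smooth function on all of $\mathbb R\times T^1M$ such that these equations hold in every chart. Moreover, in each chart $\varepsilon_x=A_x+B_{xx}\ddot x+B_{xy}\ddot y$ and $\varepsilon_y=A_y+B_{yx}\ddot x+B_{yy}\ddot y$, with coefficients depending on $(x,y,\dot x,\dot y)$ only. Put $C=\frac12\left(\frac{\partial A_x}{\partial\dot y}-\frac{\partial A_y}{\partial\dot x}\right)$. The chart expressions $$\mu_0=-(A_x-C\dot y)\,t\,dx-(A_y+C\dot x)\,t\,dy-(B_{xx}\dot x+B_{xy}\dot y)\,t\,d\dot x-(B_{xy}\dot x+B_{yy}\dot y)\,t\,d\dot y,$$ $$\kappa=-\Big(\int_0^{\dot x}B_{xx}(x,y,\nu,\dot y)\,d\nu+\int_0^{\dot y}B_{xy}(x,y,0,\sigma)\,d\sigma\Big)dx-\Big(\int_0^{\dot x}B_{xy}(x,y,\nu,\dot y)\,d\nu+\int_0^{\dot y}B_{yy}(x,y,0,\sigma)\,d\sigma\Big)dy,$$ $$\omega=C(x,y,0,0)\,dx\wedge dy$$ define a smooth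 $1$-form $\mu_0$ on $\mathbb R\times T^1M$, a smooth $1$-form $\kappa$ on $T^1M$ and a smooth $2$-form $\omega$ on $M$. The equation $\omega=d\eta$ has a smooth solution $\eta$ on all of $M$. For every such solution $\eta$, $$\lambda=h(\mu_0+\kappa+\eta)$$ is a Lagrangian on $\mathbb R\times T^2M$ whose Euler–Lagrange form is $\varepsilon$. Here $\kappa$ and $\eta$ are pulled back to $\mathbb R\times T^1M$, and $h$ is the horizontalization, given by $h\,dt=dt$, $h\,dx=\dot x\,dt$, $h\,dy=\dot y\,dt$, $h\,d\dot x=\ddot x\,dt$, $h\,d\dot y=\ddot y\,dt$. If $\lambda=\mathscr L\,dt$, then $\mathscr L$ depends on $(t,x,y,\dot x,\dot y,\ddot x,\ddot y)$, and its Euler–Lagrange expressions are $$\frac{\partial\mathscr L}{\partial x}-\frac{d}{dt}\frac{\partial\mathscr L}{\partial\dot x}+\frac{d^2}{dt^2}\frac{\partial\mathscr L}{\partial\ddot x},\qquad \frac{\partial\mathscr L}{\partial y}-\frac{d}{dt}\frac{\partial\mathscr L}{\partial\dot y}+\frac{d^2}{dt^2}\frac{\partial\mathscr L}{\partial\ddot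 y}.$$ -/

import Mathlib

open Set Topology
open scoped Manifold ContDiff

noncomputable section

namespace GlobalLagrangian

/-! ## Coordinates

`Plane` carries the coordinates `(x⁰, x¹) = (x, y)` of a chart of the 2-manifold `M`.  The charts
that such a chart induces on `T¹M`, `ℝ × T¹M`, `ℝ × T²M` have the coordinates
`(x, v)`, `(t, x, v)`, `(t, x, v, a)`, where `v = (ẋ, ẏ)` and `a = (ẍ, ÿ)`. -/

abbrev Plane : Type := EuclideanSpace ℝ (Fin 2)

abbrev TCoord : Type := Plane × Plane

abbrev RT1Coord : Type := ℝ × Plane × Plane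

abbrev RT2Coord : Type := ℝ × Plane × Plane × Plane

abbrev RT3Coord : Type := ℝ × Plane × Plane × Plane × Plane

abbrev RT4Coord : Type := ℝ × Plane × Plane × Plane × Plane × Plane

/-- The coordinate vector `∂/∂xⁱ` of the plane. -/
def e (i : Fin 2) : Plane := EuclideanSpace.single i 1

/-- A manifold over `M` obtained by gluing coordinate domains `{z | pos z ∈ φ.target}`, one for each
chart `φ` of `M`: `pos` is the projection to the chart of `M`, and `lift Φ` is the change of
coordinates that is induced by the change of coordinates `Φ` of `M`. -/
structure Prolongation (X : Type) where
  pos : X → Plane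
  lift : (Plane → Plane) → X → X

/-- `M` itself. -/
def base : Prolongation Plane where
  pos x := x
  lift Φ x := Φ x

/-- `T¹M`. -/
def tangent : Prolongation TCoord where
  pos z := z.1
  lift Φ z := (Φ z.1, fderiv ℝ Φ z.1 z.2)

/-- `ℝ × T¹M`. -/
def jet1 : Prolongation RT1Coord where
  pos z := z.2.1
  lift Φ z := (z.1, Φ z.2.1, fderiv ℝ Φ z.2.1 z.2.2)

/-- `ℝ × T²M`, where `T²M` is the manifold of 2-jets at `0` of curves in `M`: if `ζ` is a curve with
`ζ(0) = x`, `ζ'(0) = v`, `ζ''(0) = a`, then `Φ ∘ ζ` has the value `Φ(x)`, the velocity `DΦ(x) v` and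
the acceleration `D²Φ(x)(v, v) + DΦ(x) a` at `0`. -/
def jet2 : Prolongation RT2Coord where
  pos z := z.2.1
  lift Φ z := (z.1, Φ z.2.1, fderiv ℝ Φ z.2.1 z.2.2.1,
    fderiv ℝ (fderiv ℝ Φ) z.2.1 z.2.2.1 z.2.2.1 + fderiv ℝ Φ z.2.1 z.2.2.2)

/-- The projection `(t, x, v) ↦ x`. -/
def prBase : RT1Coord →L[ℝ] Plane :=
  (ContinuousLinearMap.fst ℝ Plane Plane).comp (ContinuousLinearMap.snd ℝ ℝ (Plane × Plane))

/-- The projection `(t, x, v) ↦ (x, v)`. -/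
def prTangent : RT1Coord →L[ℝ] TCoord := ContinuousLinearMap.snd ℝ ℝ (Plane × Plane)

/-! ## Differential forms -/

section Forms

variable {X Y : Type} [NormedAddCommGroup X] [NormedSpace ℝ X]
  [NormedAddCommGroup Y] [NormedSpace ℝ Y]

/-- A covector as an alternating 1-form. -/
def oneForm (α : X →L[ℝ] ℝ) : X [⋀^Fin 1]→L[ℝ] ℝ :=
  ContinuousAlternatingMap.ofSubsingleton ℝ X ℝ (0 : Fin 1) α

/-- The exterior product of two covectors, `(α ∧ β)(u, w) = α(u) β(w) - α(w) β(u)`. -/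
def wedge (α β : X →L[ℝ] ℝ) : X [⋀^Fin 2]→L[ℝ] ℝ :=
  ContinuousMultilinearMap.alternatization
    ((ContinuousMultilinearMap.mkPiAlgebra ℝ (Fin 2) ℝ).compContinuousLinearMap ![α, β])

theorem wedge_apply (α β : X →L[ℝ] ℝ) (w : Fin 2 → X) :
    wedge α β w = α (w 0) * β (w 1) - α (w 1) * β (w 0) := by
  have hu : (Finset.univ : Finset (Equiv.Perm (Fin 2))) = {1, Equiv.swap 0 1} := by decide
  have hne : (1 : Equiv.Perm (Fin 2)) ≠ Equiv.swap 0 1 := by decide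
  rw [wedge, ContinuousMultilinearMap.alternatization_apply_apply, hu, Finset.sum_pair hne]
  simp [Fin.prod_univ_two, sub_eq_add_neg]

/-- The local expressions, in all charts of `M`, of a `k`-form on a prolongation of `M`.  Only the
values on the coordinate domains of the charts in the maximal smooth atlas matter. -/
abbrev FormFamily (M : Type*) [TopologicalSpace M] (X : Type) [NormedAddCommGroup X]
    [NormedSpace ℝ X] (k : ℕ) : Type _ :=
  OpenPartialHomeomorph M Plane → X → X [⋀^Fin k]→L[ℝ] ℝ

variable {M : Type*} [TopologicalSpace M]

/-- The pull-back of a form by a projection that is linear in all charts. -/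
def pullback (p : X →L[ℝ] Y) {k : ℕ} (ρ : FormFamily M Y k) : FormFamily M X k :=
  fun φ z => (ρ φ (p z)).compContinuousLinearMap p

variable [ChartedSpace Plane M]

/-- `ρ` is a smooth differential `k`-form on the prolongation `N` of `M`: the local expressions are
smooth, and they are pull-backs of each other under the changes of coordinates. -/
def IsForm (N : Prolongation X) {k : ℕ} (ρ : FormFamily M X k) : Prop :=
  (∀ φ ∈ IsManifold.maximalAtlas (𝓡 2) ∞ M, ContDiffOn ℝ ∞ (ρ φ) {z | N.pos z ∈ φ.target}) ∧
  ∀ φ ∈ IsManifold.maximalAtlas (𝓡 2) ∞ M, ∀ φ' ∈ IsManifold.maximalAtlas (𝓡 2) ∞ M,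
    ∀ z, N.pos z ∈ φ.target → φ.symm (N.pos z) ∈ φ'.source →
      ρ φ z = (ρ φ' (N.lift (φ' ∘ φ.symm) z)).compContinuousLinearMap
        (fderiv ℝ (N.lift (φ' ∘ φ.symm)) z)

/-- Equality of two forms on the prolongation `N` of `M`. -/
def EqForm (N : Prolongation X) {k : ℕ} (ρ σ : FormFamily M X k) : Prop :=
  ∀ φ ∈ IsManifold.maximalAtlas (𝓡 2) ∞ M, ∀ z, N.pos z ∈ φ.target → ρ φ z = σ φ z

/-- The exterior derivative, in charts. -/
def d {k : ℕ} (ρ : FormFamily M X k) : FormFamily M X (k + 1) :=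
  fun φ => extDeriv (ρ φ)

end Forms

/-- `H²_dR(M) = 0`: each closed smooth 2-form on `M` is the exterior derivative of a smooth
1-form on `M`. -/
def DeRhamH2Trivial (M : Type*) [TopologicalSpace M] [ChartedSpace Plane M] : Prop :=
  ∀ ρ : FormFamily M Plane 2, IsForm base ρ → EqForm base (d ρ) (fun _ _ => 0) →
    ∃ η : FormFamily M Plane 1, IsForm base η ∧ EqForm base (d η) ρ

/-! ## Coordinate 1-forms -/

/-- `dxⁱ` on `M`. -/
def dxBase (i : Fin 2) : Plane →L[ℝ] ℝ := EuclideanSpace.proj i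

/-- `dxⁱ` on `T¹M`. -/
def dxT (i : Fin 2) : TCoord →L[ℝ] ℝ := (dxBase i).comp (ContinuousLinearMap.fst ℝ Plane Plane)

/-- `dxⁱ` on `ℝ × T¹M`. -/
def dx1 (i : Fin 2) : RT1Coord →L[ℝ] ℝ := (dxBase i).comp prBase

/-- `dẋⁱ` on `ℝ × T¹M`. -/
def dv1 (i : Fin 2) : RT1Coord →L[ℝ] ℝ :=
  (dxBase i).comp ((ContinuousLinearMap.snd ℝ Plane Plane).comp prTangent)

/-- `dt` on `ℝ × T¹M`. -/
def dt1 : RT1Coord →L[ℝ] ℝ := ContinuousLinearMap.fst ℝ ℝ (Plane × Plane)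

/-- `dt` on `ℝ × T²M`. -/
def dt2 : RT2Coord →L[ℝ] ℝ := ContinuousLinearMap.fst ℝ ℝ (Plane × Plane × Plane)

/-- `dxⁱ` on `ℝ × T²M`. -/
def dx2 (i : Fin 2) : RT2Coord →L[ℝ] ℝ :=
  (dxBase i).comp ((ContinuousLinearMap.fst ℝ Plane (Plane × Plane)).comp
    (ContinuousLinearMap.snd ℝ ℝ (Plane × Plane × Plane)))

/-- The contact form `ωⁱ = dxⁱ - ẋⁱ dt` at the point `z` of `ℝ × T²M`. -/
def contactForm (i : Fin 2) (z : RT2Coord) : RT2Coord →L[ℝ] ℝ :=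
  dx2 i - z.2.2.1 i • dt2

section Variational

variable {M : Type*} [TopologicalSpace M]

/-- The coefficient `εᵢ = ε(∂/∂xⁱ, ∂/∂t)` of `ε = (ε₀ ω⁰ + ε₁ ω¹) ∧ dt` in the chart `φ`. -/
def coeff (ε : FormFamily M RT2Coord 2) (φ : OpenPartialHomeomorph M Plane) (i : Fin 2)
    (z : RT2Coord) : ℝ :=
  ε φ z ![(0, e i, 0, 0), (1, 0, 0, 0)]

/-- The horizontalization `h` of a 1-form on `ℝ × T¹M`: `h dt = dt`, `h dxⁱ = ẋⁱ dt`,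
`h dẋⁱ = ẍⁱ dt`, and `h f = f` on functions. -/
def horizontalization (ρ : FormFamily M RT1Coord 1) : FormFamily M RT2Coord 1 :=
  fun φ z => ρ φ (z.1, z.2.1, z.2.2.1) (fun _ => (1, z.2.2.1, z.2.2.2)) • oneForm dt2

/-- The Lagrange function `L` of a first-order Lagrangian `L dt`, in the chart `φ`. -/
def lagrangeFunction1 (lam : FormFamily M RT1Coord 1) (φ : OpenPartialHomeomorph M Plane)
    (z : RT1Coord) : ℝ :=
  lam φ z (fun _ => (1, 0, 0))

/-- The Lagrange function `L` of a second-order Lagrangian `L dt`, in the chart `φ`. -/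
def lagrangeFunction2 (lam : FormFamily M RT2Coord 1) (φ : OpenPartialHomeomorph M Plane)
    (z : RT2Coord) : ℝ :=
  lam φ z (fun _ => (1, 0, 0, 0))

/-! ## Euler-Lagrange expressions -/

/-- The total derivative `d/dt` of a function of `(t, x, v)`. -/
def totalDeriv1 (f : RT1Coord → ℝ) : RT2Coord → ℝ :=
  fun (t, x, v, a) => fderiv ℝ f (t, x, v) (1, v, a)

/-- The total derivative `d/dt` of a function of `(t, x, v, a)`. -/
def totalDeriv2 (f : RT2Coord → ℝ) : RT3Coord → ℝ :=
  fun (t, x, v, a, b) => fderiv ℝ f (t, x, v, a) (1, v, a, b)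

/-- The total derivative `d/dt` of a function of `(t, x, v, a, b)`. -/
def totalDeriv3 (f : RT3Coord → ℝ) : RT4Coord → ℝ :=
  fun (t, x, v, a, b, c) => fderiv ℝ f (t, x, v, a, b) (1, v, a, b, c)

/-- `Eᵢ(L) = ∂L/∂xⁱ - d/dt ∂L/∂ẋⁱ` for a function `L(t, x, v)`. -/
def eulerLagrange1 (L : RT1Coord → ℝ) (i : Fin 2) : RT2Coord → ℝ :=
  fun (t, x, v, a) => fderiv ℝ L (t, x, v) (0, e i, 0)
    - totalDeriv1 (fun w => fderiv ℝ L w (0, 0, e i)) (t, x, v, a)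

/-- `Eᵢ(L) = ∂L/∂xⁱ - d/dt ∂L/∂ẋⁱ + d²/dt² ∂L/∂ẍⁱ` for a function `L(t, x, v, a)`. -/
def eulerLagrange2 (L : RT2Coord → ℝ) (i : Fin 2) : RT4Coord → ℝ :=
  fun (t, x, v, a, b, c) => fderiv ℝ L (t, x, v, a) (0, e i, 0, 0)
    - totalDeriv2 (fun w => fderiv ℝ L w (0, 0, e i, 0)) (t, x, v, a, b)
    + totalDeriv3 (totalDeriv2 (fun w => fderiv ℝ L w (0, 0, 0, e i))) (t, x, v, a, b, c)

/-! ## The forms `μ₀`, `κ`, `ω` -/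

/-- `Aᵢ(x, v)`, the value of `εᵢ` at `a = 0`, for a source form that does not depend on `t`. -/
def coeffA (ε : FormFamily M RT2Coord 2) (φ : OpenPartialHomeomorph M Plane) (i : Fin 2)
    (z : TCoord) : ℝ :=
  coeff ε φ i (0, z.1, z.2, 0)

/-- `Bᵢⱼ(x, v)`, the factor of `aʲ` in `εᵢ = Aᵢ + Bᵢ₀ a⁰ + Bᵢ₁ a¹`. -/
def coeffB (ε : FormFamily M RT2Coord 2) (φ : OpenPartialHomeomorph M Plane) (i j : Fin 2)
    (z : TCoord) : ℝ :=
  coeff ε φ i (0, z.1, z.2, e j) - coeff ε φ i (0, z.1, z.2, 0)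

/-- `½ (∂A₀/∂ẏ - ∂A₁/∂ẋ)`. -/
def coeffC (ε : FormFamily M RT2Coord 2) (φ : OpenPartialHomeomorph M Plane) (z : TCoord) : ℝ :=
  (1 / 2) * (fderiv ℝ (coeffA ε φ 0) z (0, e 1) - fderiv ℝ (coeffA ε φ 1) z (0, e 0))

/-- `μ₀ = - (A₀ - Cẏ) t dx - (A₁ + Cẋ) t dy - (B₀₀ẋ + B₀₁ẏ) t dẋ - (B₀₁ẋ + B₁₁ẏ) t dẏ`,
where `C = ½ (∂A₀/∂ẏ - ∂A₁/∂ẋ)`. -/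
def muZero (ε : FormFamily M RT2Coord 2) : FormFamily M RT1Coord 1 :=
  fun φ (t, x, v) => oneForm (
    - ((coeffA ε φ 0 (x, v) - coeffC ε φ (x, v) * v 1) * t) • dx1 0
    - ((coeffA ε φ 1 (x, v) + coeffC ε φ (x, v) * v 0) * t) • dx1 1
    - ((coeffB ε φ 0 0 (x, v) * v 0 + coeffB ε φ 0 1 (x, v) * v 1) * t) • dv1 0
    - ((coeffB ε φ 0 1 (x, v) * v 0 + coeffB ε φ 1 1 (x, v) * v 1) * t) • dv1 1)

/-- `κ = - (∫₀^ẋ B₀₀(x, y, ν, ẏ) dν + ∫₀^ẏ B₀₁(x, y, 0, σ) dσ) dx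
        - (∫₀^ẋ B₀₁(x, y, ν, ẏ) dν + ∫₀^ẏ B₁₁(x, y, 0, σ) dσ) dy`. -/
def kappa (ε : FormFamily M RT2Coord 2) : FormFamily M TCoord 1 :=
  fun φ (x, v) => oneForm (
    - ((∫ ν in (0 : ℝ)..(v 0), coeffB ε φ 0 0 (x, !₂[ν, v 1]))
        + ∫ σ in (0 : ℝ)..(v 1), coeffB ε φ 0 1 (x, !₂[0, σ])) • dxT 0
    - ((∫ ν in (0 : ℝ)..(v 0), coeffB ε φ 0 1 (x, !₂[ν, v 1]))
        + ∫ σ in (0 : ℝ)..(v 1), coeffB ε φ 1 1 (x, !₂[0, σ])) • dxT 1)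

/-- `ω = ½ (∂A₀/∂ẏ - ∂A₁/∂ẋ)(x, y, 0, 0) dx ∧ dy`. -/
def omega (ε : FormFamily M RT2Coord 2) : FormFamily M Plane 2 :=
  fun φ x => coeffC ε φ (x, 0) • wedge (dxBase 0) (dxBase 1)

/-- `h(μ₀ + κ + η)`. -/
def globalLagrangian (ε : FormFamily M RT2Coord 2) (η : FormFamily M Plane 1) :
    FormFamily M RT2Coord 1 :=
  horizontalization (muZero ε + pullback prTangent (kappa ε) + pullback prBase η)

variable [ChartedSpace Plane M]

/-! ## Source forms and variationality -/

/-- `ε` is a source form on `ℝ × T²M`: a smooth 2-form that is 1-contact and horizontal over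
`ℝ × M`, i.e. of the form `(ε₀ ω⁰ + ε₁ ω¹) ∧ dt` in each chart. -/
def IsSourceForm (ε : FormFamily M RT2Coord 2) : Prop :=
  IsForm jet2 ε ∧
  ∀ φ ∈ IsManifold.maximalAtlas (𝓡 2) ∞ M, ∀ z, jet2.pos z ∈ φ.target →
    ε φ z = wedge (coeff ε φ 0 z • contactForm 0 z + coeff ε φ 1 z • contactForm 1 z) dt2

/-- The coefficients of `ε` do not depend on the time variable `t` explicitly. -/
def IsTimeIndependent (ε : FormFamily M RT2Coord 2) : Prop :=
  ∀ φ ∈ IsManifold.maximalAtlas (𝓡 2) ∞ M, ∀ (i : Fin 2) (t s : ℝ) (x v a : Plane),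
    x ∈ φ.target → coeff ε φ i (t, x, v, a) = coeff ε φ i (s, x, v, a)

/-- The coefficients of `ε` are affine in the accelerations, `εᵢ = Aᵢ + Bᵢ₀ a⁰ + Bᵢ₁ a¹`. -/
def IsAffineInAcceleration (ε : FormFamily M RT2Coord 2) : Prop :=
  ∀ φ ∈ IsManifold.maximalAtlas (𝓡 2) ∞ M, ∀ (i : Fin 2) (t : ℝ) (x v a : Plane),
    x ∈ φ.target → coeff ε φ i (t, x, v, a) =
      coeffA ε φ i (x, v) + coeffB ε φ i 0 (x, v) * a 0 + coeffB ε φ i 1 (x, v) * a 1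

/-- `ε` is locally variational: each point of `ℝ × M` has a chart neighbourhood `J × U`, where `U` is
the domain of a chart `φ` of `M`, and a smooth function `L(t, x, v)` on its preimage in `ℝ × T¹M`,
such that the coefficients of `ε` are the Euler-Lagrange expressions of `L`. -/
def IsLocallyVariational (ε : FormFamily M RT2Coord 2) : Prop :=
  ∀ (t₀ : ℝ) (p : M), ∃ φ ∈ IsManifold.maximalAtlas (𝓡 2) ∞ M, p ∈ φ.source ∧
    ∃ J : Set ℝ, IsOpen J ∧ t₀ ∈ J ∧ ∃ L : RT1Coord → ℝ,
      ContDiffOn ℝ ∞ L {z | z.1 ∈ J ∧ z.2.1 ∈ φ.target} ∧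
      ∀ (i : Fin 2) (t : ℝ) (x v a : Plane), t ∈ J → x ∈ φ.target →
        coeff ε φ i (t, x, v, a) = eulerLagrange1 L i (t, x, v, a)

/-- `lam = L dt` is a first-order Lagrangian defined on all of `ℝ × T¹M`. -/
def IsLagrangian1 (lam : FormFamily M RT1Coord 1) : Prop :=
  IsForm jet1 lam ∧ EqForm jet1 lam (fun φ z => lagrangeFunction1 lam φ z • oneForm dt1)

/-- `lam = L dt` is a second-order Lagrangian defined on all of `ℝ × T²M`. -/
def IsLagrangian2 (lam : FormFamily M RT2Coord 1) : Prop :=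
  IsForm jet2 lam ∧ EqForm jet2 lam (fun φ z => lagrangeFunction2 lam φ z • oneForm dt2)

/-- The source form `ε` is the Euler-Lagrange form of the first-order Lagrangian `lam`. -/
def IsEulerLagrangeForm1 (ε : FormFamily M RT2Coord 2) (lam : FormFamily M RT1Coord 1) : Prop :=
  ∀ φ ∈ IsManifold.maximalAtlas (𝓡 2) ∞ M, ∀ (i : Fin 2) (t : ℝ) (x v a : Plane),
    x ∈ φ.target →
      coeff ε φ i (t, x, v, a) = eulerLagrange1 (lagrangeFunction1 lam φ) i (t, x, v, a)

/-- The source form `ε` is the Euler-Lagrange form of the second-order Lagrangian `lam` (a priori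
the Euler-Lagrange expressions of `lam` depend on derivatives up to order four). -/
def IsEulerLagrangeForm2 (ε : FormFamily M RT2Coord 2) (lam : FormFamily M RT2Coord 1) : Prop :=
  ∀ φ ∈ IsManifold.maximalAtlas (𝓡 2) ∞ M, ∀ (i : Fin 2) (t : ℝ) (x v a b c : Plane),
    x ∈ φ.target →
      coeff ε φ i (t, x, v, a) = eulerLagrange2 (lagrangeFunction2 lam φ) i (t, x, v, a, b, c)

/-- `ε` is globally variational: it is the Euler-Lagrange form of a first-order Lagrangian that is
defined on all of `ℝ × T¹M`. -/
def IsGloballyVariational (ε : FormFamily M RT2Coord 2) : Prop :=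
  ∃ lam : FormFamily M RT1Coord 1, IsLagrangian1 lam ∧ IsEulerLagrangeForm1 ε lam

end Variational

end GlobalLagrangian

end

/-! Locally everything is expressed through a Lagrangian `l(x, v)` without time. If the
Euler–Lagrange expressions of `L(t, x, v)` do not depend on `t`, then freezing `L` at `t = 0`
changes them by `∂²L/∂t∂v` only. This term is independent of `v` and, read as a 1-form in `x`,
closed; on a ball it is therefore the differential of a function of `x`, which is added to the
frozen Lagrangian (`exists_autonomousEL_eq`). Euler–Lagrange expressions are natural under changes
of coordinates, so such an `l` exists near each point of each chart
(`exists_isAutonomousLagrangian`).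

Let `E = ∂l/∂v · v - l` be the energy, `p = ∂l/∂v` the momentum and `θ = p(x, 0) dx`. Then `μ₀ = t
dE`, `κ = (p(x, v) - p(x, 0)) dx` and `ω = dθ` (`muZero_eq`, `kappa_eq`, `omega_eq`). The left sides
are built from `ε` alone and the right sides are natural. Comparing two charts with the same `l`,
transported from one to the other, shows that these are forms; no uniqueness of `l` is needed.

In dimension two `ω` is closed, so the hypothesis on cohomology gives `η` with `dη = ω`. The
Lagrange function of `h(μ₀ + κ + η)` is `t dE/dt + (p - θ + η)(v) = d(tE)/dt + l + (η - θ)(v)`. The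
first summand is a total derivative, and the last contributes nothing because `η - θ` is closed.
What remains is `l`, hence `ε`.

For order one, `∫₀¹ κ(x, s v)(v) ds = l(x, v) - l(x, 0) - θ(v)`. The unwanted `-l(x, 0)` cannot
simply be dropped, since `l` is only local; but `Aᵢ(x, 0) = ∂l/∂xⁱ(x, 0)` is global, and subtracting
`t ∑ Aᵢ(x, 0) vⁱ` completes it to the total derivative `-d(t l(x, 0))/dt`. So `firstOrderFunction`
is globally defined and equals `l + (η - θ)(v)` up to a null Lagrangian. -/

noncomputable section

namespace GlobalLagrangian


/-! ## Second derivatives -/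

section Calculus

variable {X Y Z : Type*} [NormedAddCommGroup X] [NormedSpace ℝ X]
  [NormedAddCommGroup Y] [NormedSpace ℝ Y] [NormedAddCommGroup Z] [NormedSpace ℝ Z]

theorem two_le_infty : (2 : WithTop ℕ∞) ≤ ∞ := 
  WithTop.coe_le_coe.2 (le_top : (2 : ℕ∞) ≤ ⊤)

theorem contDiffAt_fderiv {f : X → Y} {z : X} (hf : ContDiffAt ℝ ∞ f z) :
    ContDiffAt ℝ ∞ (fderiv ℝ f) z :=
  hf.fderiv_right (by simp)

theorem differentiableAt_of_contDiffAt {f : X → Y} {z : X} (hf : ContDiffAt ℝ ∞ f z) :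
    DifferentiableAt ℝ f z :=
  hf.differentiableAt (by simp)

theorem fderiv_fderiv_comm {f : X → Y} {z : X} (hf : ContDiffAt ℝ ∞ f z) (u w : X) :
    fderiv ℝ (fderiv ℝ f) z u w = fderiv ℝ (fderiv ℝ f) z w u :=
  (hf.isSymmSndFDerivAt (by simpa using two_le_infty)).eq u w

/-- Being `C^∞` at a point in the sense of `ContDiffAt` does not spread to a neighbourhood, whereas
each finite order does. Order two suffices for the identities that have to hold near a point before
they are differentiated there. -/
theorem eventually_contDiffAt_two {f : X → Y} {z : X} (hf : ContDiffAt ℝ ∞ f z) :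
    ∀ᶠ y in 𝓝 z, ContDiffAt ℝ 2 f y :=
  (hf.of_le two_le_infty : ContDiffAt ℝ 2 f z).eventually (by simp)

theorem hasFDerivAt_clm_apply_const {c : X → Y →L[ℝ] Z} {z : X} (hc : DifferentiableAt ℝ c z)
    (y : Y) : HasFDerivAt (fun x => c x y) ((fderiv ℝ c z).flip y) z := by
  simpa using hc.hasFDerivAt.clm_apply (hasFDerivAt_const y z)

theorem fderiv_clm_apply_const {c : X → Y →L[ℝ] Z} {z : X} (hc : DifferentiableAt ℝ c z)
    (y : Y) (u : X) : fderiv ℝ (fun x => c x y) z u = fderiv ℝ c z u y := by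
  rw [(hasFDerivAt_clm_apply_const hc y).fderiv]; rfl

theorem fderiv_fderiv_apply_const {f : X → Y} {z : X} (hf : ContDiffAt ℝ ∞ f z) (u w : X) :
    fderiv ℝ (fun x => fderiv ℝ f x w) z u = fderiv ℝ (fderiv ℝ f) z u w :=
  fderiv_clm_apply_const (differentiableAt_of_contDiffAt (contDiffAt_fderiv hf)) w u

theorem fderiv_fderiv_fderiv_comm_right {f : X → Y} {z : X} (hf : ContDiffAt ℝ ∞ f z)
    (r u w : X) :
    fderiv ℝ (fderiv ℝ (fderiv ℝ f)) z r u w = fderiv ℝ (fderiv ℝ (fderiv ℝ f)) z r w u := by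
  have h2 : DifferentiableAt ℝ (fderiv ℝ (fderiv ℝ f)) z :=
    differentiableAt_of_contDiffAt (contDiffAt_fderiv (contDiffAt_fderiv hf))
  have key : ∀ p q : X, fderiv ℝ (fun x => fderiv ℝ (fderiv ℝ f) x p q) z r =
      fderiv ℝ (fderiv ℝ (fderiv ℝ f)) z r p q := fun p q => by
    rw [fderiv_clm_apply_const (hasFDerivAt_clm_apply_const h2 p).differentiableAt q r,
      fderiv_clm_apply_const h2 p r]
  rw [← key, ← key]
  -- The second derivative is symmetric at all points near `z`, so that its symmetry may be
  -- differentiated in the direction `r`.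
  refine congrArg (fun A : X →L[ℝ] Y => A r) (Filter.EventuallyEq.fderiv_eq ?_)
  filter_upwards [eventually_contDiffAt_two hf] with y hy
  exact (hy.isSymmSndFDerivAt (by simp)).eq u w

theorem fderiv_fderiv_fderiv_comm_left {f : X → Y} {z : X} (hf : ContDiffAt ℝ ∞ f z)
    (r u w : X) :
    fderiv ℝ (fderiv ℝ (fderiv ℝ f)) z r u w = fderiv ℝ (fderiv ℝ (fderiv ℝ f)) z u r w := by
  rw [fderiv_fderiv_comm (contDiffAt_fderiv hf)]

theorem fderiv_comp_clm {f : Y → Z} (p : X →L[ℝ] Y) {z : X} (hf : DifferentiableAt ℝ f (p z))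
    (u : X) : fderiv ℝ (fun x => f (p x)) z u = fderiv ℝ f (p z) (p u) := by
  have h : HasFDerivAt (fun x => f (p x)) ((fderiv ℝ f (p z)).comp p) z :=
    hf.hasFDerivAt.comp z p.hasFDerivAt
  rw [h.fderiv]; rfl

theorem fderiv_fderiv_comp_clm {f : Y → Z} (p : X →L[ℝ] Y) {z : X} (hf : ContDiffAt ℝ ∞ f (p z))
    (u w : X) : fderiv ℝ (fderiv ℝ (fun x => f (p x))) z u w
      = fderiv ℝ (fderiv ℝ f) (p z) (p u) (p w) := by
  have hc : ContDiffAt ℝ ∞ (fun x => f (p x)) z := hf.comp z p.contDiff.contDiffAt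
  rw [← fderiv_fderiv_apply_const hc, ← fderiv_fderiv_apply_const hf]
  have h : (fun x => fderiv ℝ (fun x => f (p x)) x w) =ᶠ[𝓝 z]
      fun x => (fun y => fderiv ℝ f y (p w)) (p x) := by
    filter_upwards [p.continuous.continuousAt.eventually (eventually_contDiffAt_two hf)] with x hx
    exact fderiv_comp_clm p (hx.differentiableAt (by simp)) w
  rw [h.fderiv_eq, fderiv_comp_clm (f := fun y => fderiv ℝ f y (p w)) p]
  exact (hasFDerivAt_clm_apply_const
    (differentiableAt_of_contDiffAt (contDiffAt_fderiv hf)) _).differentiableAt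

theorem contDiffAt_fderiv_apply {f : X → Y} {s : X → X} {z : X} (hf : ContDiffAt ℝ ∞ f z)
    (hs : ContDiffAt ℝ ∞ s z) : ContDiffAt ℝ ∞ (fun x => fderiv ℝ f x (s x)) z :=
  (contDiffAt_fderiv hf).clm_apply hs

end Calculus

/-! ## Forms of degree one and two -/

section Forms

variable {X Y : Type} [NormedAddCommGroup X] [NormedSpace ℝ X]
  [NormedAddCommGroup Y] [NormedSpace ℝ Y]

@[simp]
theorem oneForm_apply (α : X →L[ℝ] ℝ) (w : Fin 1 → X) : oneForm α w = α (w 0) := rfl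

theorem oneForm_compContinuousLinearMap (α : Y →L[ℝ] ℝ) (f : X →L[ℝ] Y) :
    (oneForm α).compContinuousLinearMap f = oneForm (α.comp f) := rfl

theorem contDiffAt_oneForm {α : Y → X →L[ℝ] ℝ} {z : Y} (h : ContDiffAt ℝ ∞ α z) :
    ContDiffAt ℝ ∞ (fun y => oneForm (α y)) z :=
  (ContinuousAlternatingMap.ofSubsingletonLIE (𝕜 := ℝ) (E := X) (F := ℝ) (0 : Fin 1)).contDiff.contDiffAt.comp z h

/-- The covector of an alternating 1-form. -/
def covector : (X [⋀^Fin 1]→L[ℝ] ℝ) →L[ℝ] (X →L[ℝ] ℝ) :=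
  ((ContinuousAlternatingMap.ofSubsingletonLIE (𝕜 := ℝ) (E := X) (F := ℝ) (0 : Fin 1)).symm : _ →L[ℝ] _)

theorem covector_apply (ρ : X [⋀^Fin 1]→L[ℝ] ℝ) (w : X) : covector ρ w = ρ fun _ => w := rfl

theorem extDeriv_one_apply {ρ : X → X [⋀^Fin 1]→L[ℝ] ℝ} {x : X} (h : DifferentiableAt ℝ ρ x)
    (w : Fin 2 → X) : extDeriv ρ x w =
      fderiv ℝ (fun y => covector (ρ y)) x (w 0) (w 1)
        - fderiv ℝ (fun y => covector (ρ y)) x (w 1) (w 0) := by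
  have hc : DifferentiableAt ℝ (fun y => covector (ρ y)) x :=
    (covector.differentiableAt).comp x h
  have key : ∀ v : Fin 1 → X, (fun y => ρ y v) = fun y => covector (ρ y) (v 0) := fun v => by
    funext y
    rw [covector_apply]
    congr 1; funext i; rw [Subsingleton.elim i 0]
  rw [extDeriv_apply h, Fin.sum_univ_two]
  simp only [key, fderiv_clm_apply_const hc]
  simp [Fin.removeNth, sub_eq_add_neg]

end Forms

/-! ## Coordinates of the plane -/

theorem plane_eq (w : Plane) : w = w 0 • e 0 + w 1 • e 1 := by
  ext i; fin_cases i <;> simp [e]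

theorem map_plane {F : Type*} [AddCommGroup F] [Module ℝ F] (f : Plane →ₗ[ℝ] F) (w : Plane) :
    f w = w 0 • f (e 0) + w 1 • f (e 1) := by
  conv_lhs => rw [plane_eq w]
  simp


/-! ## Changes of coordinates -/

section Transition

variable {M : Type*} [TopologicalSpace M]

/-- The part of the target of `φ` on which the change of coordinates to `φ'` is defined. -/
def overlap (φ φ' : OpenPartialHomeomorph M Plane) : Set Plane :=
  φ.target ∩ φ.symm ⁻¹' φ'.source

theorem isOpen_overlap (φ φ' : OpenPartialHomeomorph M Plane) : IsOpen (overlap φ φ') :=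
  φ.symm.isOpen_inter_preimage φ'.open_source

theorem transition_mem_target {φ φ' : OpenPartialHomeomorph M Plane} {x : Plane}
    (hx : x ∈ overlap φ φ') : (φ' ∘ φ.symm) x ∈ φ'.target :=
  φ'.map_source hx.2

variable [ChartedSpace Plane M]

theorem contDiffAt_transition {φ φ' : OpenPartialHomeomorph M Plane}
    (hφ : φ ∈ IsManifold.maximalAtlas (𝓡 2) ∞ M) (hφ' : φ' ∈ IsManifold.maximalAtlas (𝓡 2) ∞ M)
    {x : Plane} (hx : x ∈ φ.target) (hx' : φ.symm x ∈ φ'.source) :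
    ContDiffAt ℝ ∞ (φ' ∘ φ.symm) x := by
  rw [← contMDiffAt_iff_contDiffAt]
  have h1 : ContMDiffAt (𝓡 2) (𝓡 2) ∞ φ.symm x :=
    (contMDiffOn_symm_of_mem_maximalAtlas hφ).contMDiffAt (φ.open_target.mem_nhds hx)
  have h2 : ContMDiffAt (𝓡 2) (𝓡 2) ∞ φ' (φ.symm x) :=
    (contMDiffOn_of_mem_maximalAtlas hφ').contMDiffAt (φ'.open_source.mem_nhds hx')
  exact h2.comp x h1

end Transition

/-! ### Prolongations of a change of coordinates and their derivatives -/

section Lift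

variable {Φ : Plane → Plane}

theorem contDiffAt_tangent_lift {z : TCoord} (hΦ : ContDiffAt ℝ ∞ Φ z.1) :
    ContDiffAt ℝ ∞ (tangent.lift Φ) z :=
  (hΦ.comp z contDiffAt_fst).prodMk
    (((contDiffAt_fderiv hΦ).comp z contDiffAt_fst).clm_apply contDiffAt_snd)

theorem fderiv_tangent_lift {z : TCoord} (hΦ : ContDiffAt ℝ 2 Φ z.1) (u : TCoord) :
    fderiv ℝ (tangent.lift Φ) z u =
      (fderiv ℝ Φ z.1 u.1, fderiv ℝ (fderiv ℝ Φ) z.1 u.1 z.2 + fderiv ℝ Φ z.1 u.2) := by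
  have h1 : HasFDerivAt (fun z : TCoord => Φ z.1)
      ((fderiv ℝ Φ z.1).comp (ContinuousLinearMap.fst ℝ Plane Plane)) z :=
    (hΦ.differentiableAt (by simp)).hasFDerivAt.comp z hasFDerivAt_fst
  have h2 : HasFDerivAt (fun z : TCoord => fderiv ℝ Φ z.1)
      ((fderiv ℝ (fderiv ℝ Φ) z.1).comp (ContinuousLinearMap.fst ℝ Plane Plane)) z :=
    ((hΦ.fderiv_right (m := 1) (by norm_num)).differentiableAt (by simp)).hasFDerivAt.comp z
      hasFDerivAt_fst
  have h : HasFDerivAt (tangent.lift Φ) _ z := h1.prodMk (h2.clm_apply hasFDerivAt_snd)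
  rw [h.fderiv]
  simp [add_comm]

theorem contDiffAt_jet1_lift {z : RT1Coord} (hΦ : ContDiffAt ℝ ∞ Φ z.2.1) :
    ContDiffAt ℝ ∞ (jet1.lift Φ) z :=
  contDiffAt_fst.prodMk ((contDiffAt_tangent_lift (z := z.2) hΦ).comp z contDiffAt_snd)

theorem fderiv_jet1_lift {z : RT1Coord} (hΦ : ContDiffAt ℝ ∞ Φ z.2.1) (u : RT1Coord) :
    fderiv ℝ (jet1.lift Φ) z u = (u.1, fderiv ℝ (tangent.lift Φ) z.2 u.2) := by
  have h2 : HasFDerivAt (fun z : RT1Coord => tangent.lift Φ z.2)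
      ((fderiv ℝ (tangent.lift Φ) z.2).comp (ContinuousLinearMap.snd ℝ ℝ TCoord)) z :=
    (differentiableAt_of_contDiffAt (contDiffAt_tangent_lift hΦ)).hasFDerivAt.comp z
      hasFDerivAt_snd
  have h : HasFDerivAt (jet1.lift Φ) _ z := hasFDerivAt_fst.prodMk h2
  rw [h.fderiv]
  rfl

/-- The projection `(t, x, v, a) ↦ (t, x, v)`. -/
def prJet : RT2Coord →L[ℝ] RT1Coord :=
  (ContinuousLinearMap.fst ℝ ℝ (Plane × Plane × Plane)).prod
    ((((ContinuousLinearMap.fst ℝ Plane (Plane × Plane)).prod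
      ((ContinuousLinearMap.fst ℝ Plane Plane).comp
        (ContinuousLinearMap.snd ℝ Plane (Plane × Plane))))).comp
      (ContinuousLinearMap.snd ℝ ℝ (Plane × Plane × Plane)))

@[simp]
theorem prJet_apply (z : RT2Coord) : prJet z = (z.1, z.2.1, z.2.2.1) := rfl

theorem contDiffAt_jet2_lift {z : RT2Coord} (hΦ : ContDiffAt ℝ ∞ Φ z.2.1) :
    ContDiffAt ℝ ∞ (jet2.lift Φ) z := by
  have hx : ContDiffAt ℝ ∞ (fun z : RT2Coord => z.2.1) z := contDiffAt_fst.comp z contDiffAt_snd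
  have hv : ContDiffAt ℝ ∞ (fun z : RT2Coord => z.2.2.1) z :=
    contDiffAt_fst.comp z (contDiffAt_snd.comp z contDiffAt_snd)
  have ha : ContDiffAt ℝ ∞ (fun z : RT2Coord => z.2.2.2) z :=
    contDiffAt_snd.comp z (contDiffAt_snd.comp z contDiffAt_snd)
  have h1 : ContDiffAt ℝ ∞ (fun z : RT2Coord => fderiv ℝ Φ z.2.1) z :=
    (contDiffAt_fderiv hΦ).comp z hx
  have h2 : ContDiffAt ℝ ∞ (fun z : RT2Coord => fderiv ℝ (fderiv ℝ Φ) z.2.1) z :=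
    (contDiffAt_fderiv (contDiffAt_fderiv hΦ)).comp z hx
  exact contDiffAt_fst.prodMk ((hΦ.comp z hx).prodMk ((h1.clm_apply hv).prodMk
    (((h2.clm_apply hv).clm_apply hv).add (h1.clm_apply ha))))

/-- Obtained by differentiating the identity between forgetting the acceleration after lifting and
lifting after forgetting it. This avoids the third derivatives of `Φ` in the acceleration component
of the derivative. -/
theorem prJet_fderiv_jet2_lift {z : RT2Coord} (hΦ : ContDiffAt ℝ ∞ Φ z.2.1) (u : RT2Coord) :
    prJet (fderiv ℝ (jet2.lift Φ) z u) = fderiv ℝ (jet1.lift Φ) (prJet z) (prJet u) := by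
  have h1 : HasFDerivAt (fun z => prJet (jet2.lift Φ z))
      (prJet.comp (fderiv ℝ (jet2.lift Φ) z)) z :=
    prJet.hasFDerivAt.comp z
      (differentiableAt_of_contDiffAt (contDiffAt_jet2_lift hΦ)).hasFDerivAt
  have h2 : HasFDerivAt (fun z => jet1.lift Φ (prJet z))
      ((fderiv ℝ (jet1.lift Φ) (prJet z)).comp prJet) z :=
    (differentiableAt_of_contDiffAt
      (contDiffAt_jet1_lift (z := prJet z) hΦ)).hasFDerivAt.comp z prJet.hasFDerivAt
  exact congrArg (fun A : RT2Coord →L[ℝ] RT1Coord => A u) (h1.unique h2)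

end Lift

/-! ## Operations on forms -/

section Operations

variable {M : Type*} [TopologicalSpace M] [ChartedSpace Plane M]

theorem IsForm.add {X : Type} [NormedAddCommGroup X] [NormedSpace ℝ X] {N : Prolongation X}
    {k : ℕ} {ρ σ : FormFamily M X k} (hρ : IsForm N ρ) (hσ : IsForm N σ) : IsForm N (ρ + σ) := by
  refine ⟨fun φ hφ => (hρ.1 φ hφ).add (hσ.1 φ hφ), fun φ hφ φ' hφ' z hz hz' => ?_⟩
  change ρ φ z + σ φ z = _
  rw [hρ.2 φ hφ φ' hφ' z hz hz', hσ.2 φ hφ φ' hφ' z hz hz']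
  rfl

theorem contDiff_compContinuousLinearMap {X Y : Type} [NormedAddCommGroup X] [NormedSpace ℝ X]
    [NormedAddCommGroup Y] [NormedSpace ℝ Y] (p : X →L[ℝ] Y) (k : ℕ) :
    ContDiff ℝ ∞ fun ρ : Y [⋀^Fin k]→L[ℝ] ℝ => ρ.compContinuousLinearMap p :=
  (ContinuousAlternatingMap.compContinuousLinearMapCLM p :
    (Y [⋀^Fin k]→L[ℝ] ℝ) →L[ℝ] (X [⋀^Fin k]→L[ℝ] ℝ)).contDiff

theorem IsForm.pullback_prTangent {k : ℕ} {ρ : FormFamily M TCoord k} (hρ : IsForm tangent ρ) :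
    IsForm jet1 (pullback prTangent ρ) := by
  refine ⟨fun φ hφ => ?_, fun φ hφ φ' hφ' z hz hz' => ?_⟩
  · exact (contDiff_compContinuousLinearMap prTangent k).comp_contDiffOn
      ((hρ.1 φ hφ).comp prTangent.contDiff.contDiffOn fun z hz => hz)
  · ext w
    have h := hρ.2 φ hφ φ' hφ' z.2 hz hz'
    change ρ φ z.2 _ = _
    rw [h]
    change ρ φ' _ _ = ρ φ' _ _
    congr 1
    funext i
    change fderiv ℝ (tangent.lift _) z.2 (w i).2 = (fderiv ℝ (jet1.lift _) z (w i)).2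
    rw [fderiv_jet1_lift (contDiffAt_transition hφ hφ' hz hz')]

theorem IsForm.pullback_prBase {k : ℕ} {ρ : FormFamily M Plane k} (hρ : IsForm base ρ) :
    IsForm jet1 (pullback prBase ρ) := by
  refine ⟨fun φ hφ => ?_, fun φ hφ φ' hφ' z hz hz' => ?_⟩
  · exact (contDiff_compContinuousLinearMap prBase k).comp_contDiffOn
      ((hρ.1 φ hφ).comp prBase.contDiff.contDiffOn fun z hz => hz)
  · ext w
    have h := hρ.2 φ hφ φ' hφ' z.2.1 hz hz'
    change ρ φ z.2.1 _ = _
    rw [h]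
    change ρ φ' _ _ = ρ φ' _ _
    congr 1
    funext i
    change fderiv ℝ (φ' ∘ φ.symm) z.2.1 (w i).2.1 = (fderiv ℝ (jet1.lift _) z (w i)).2.1
    rw [fderiv_jet1_lift (contDiffAt_transition hφ hφ' hz hz'),
      fderiv_tangent_lift ((contDiffAt_transition hφ hφ' hz hz').of_le two_le_infty)]

/-- The vector `(1, v, a)` defining `d/dt` is natural: the derivative of the lift to `ℝ × T¹M` sends
it to `(1, v', a')`, where `v'` and `a'` are the transformed velocity and acceleration. The form
`dt` is invariant. -/
theorem IsForm.horizontalization {ρ : FormFamily M RT1Coord 1} (hρ : IsForm jet1 ρ) :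
    IsForm jet2 (horizontalization ρ) := by
  refine ⟨fun φ hφ z hz => ContDiffAt.contDiffWithinAt ?_, fun φ hφ φ' hφ' z hz hz' => ?_⟩
  · have hopen : IsOpen {z : RT1Coord | jet1.pos z ∈ φ.target} :=
      φ.open_target.preimage prBase.continuous
    have h1 : ContDiffAt ℝ ∞ (ρ φ) (prJet z) :=
      (hρ.1 φ hφ).contDiffAt (hopen.mem_nhds hz)
    have h2 : ContDiffAt ℝ ∞ (fun z : RT2Coord => covector (ρ φ (prJet z))) z :=
      (covector (X := RT1Coord)).contDiff.contDiffAt.comp z (h1.comp z prJet.contDiff.contDiffAt)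
    have hva : ContDiffAt ℝ ∞ (fun z : RT2Coord => ((1, z.2.2.1, z.2.2.2) : RT1Coord)) z :=
      contDiffAt_const.prodMk (contDiffAt_snd.comp z contDiffAt_snd)
    exact (h2.clm_apply hva).smul contDiffAt_const
  · have hΦ := contDiffAt_transition hφ hφ' hz hz'
    ext w
    have h := hρ.2 φ hφ φ' hφ' (prJet z) hz hz'
    have hd : (fderiv ℝ (jet2.lift (φ' ∘ φ.symm)) z (w 0)).1 = (w 0).1 :=
      (congrArg Prod.fst (prJet_fderiv_jet2_lift hΦ (w 0))).trans
        (by rw [fderiv_jet1_lift hΦ]; rfl)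
    change ρ φ (prJet z) (fun _ => (1, z.2.2.1, z.2.2.2)) * (w 0).1 =
      ρ φ' (jet1.lift (φ' ∘ φ.symm) (prJet z)) (fun _ => (1, _, _)) *
        (fderiv ℝ (jet2.lift (φ' ∘ φ.symm)) z (w 0)).1
    rw [h, hd]
    congr 1
    change ρ φ' _ (fun _ => fderiv ℝ (jet1.lift (φ' ∘ φ.symm)) (prJet z) (1, z.2.2.1, z.2.2.2)) = _
    rw [fderiv_jet1_lift hΦ, fderiv_tangent_lift (hΦ.of_le two_le_infty)]
    rfl

theorem isLagrangian2_horizontalization {ρ : FormFamily M RT1Coord 1} (hρ : IsForm jet1 ρ) :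
    IsLagrangian2 (horizontalization ρ) := by
  refine ⟨hρ.horizontalization, fun φ _ z _ => ?_⟩
  ext w
  simp [lagrangeFunction2, GlobalLagrangian.horizontalization, dt2]

end Operations


/-! ## Euler-Lagrange expressions of total derivatives -/

section TotalDerivative

theorem totalDeriv1_apply (f : RT1Coord → ℝ) (z : RT2Coord) :
    totalDeriv1 f z = fderiv ℝ f (prJet z) (1, z.2.2) := rfl

/-- The projection `(t, x, v, a, b) ↦ (t, x, v, a)`. -/
def prJet3 : RT3Coord →L[ℝ] RT2Coord :=
  (ContinuousLinearMap.fst ℝ ℝ (Plane × Plane × Plane × Plane)).prod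
    (((ContinuousLinearMap.fst ℝ Plane (Plane × Plane × Plane)).prod
      (((ContinuousLinearMap.fst ℝ Plane (Plane × Plane)).prod
        ((ContinuousLinearMap.fst ℝ Plane Plane).comp
          (ContinuousLinearMap.snd ℝ Plane (Plane × Plane)))).comp
        (ContinuousLinearMap.snd ℝ Plane (Plane × Plane × Plane)))).comp
      (ContinuousLinearMap.snd ℝ ℝ (Plane × Plane × Plane × Plane)))

@[simp]
theorem prJet3_apply (z : RT3Coord) : prJet3 z = (z.1, z.2.1, z.2.2.1, z.2.2.2.1) := rfl

theorem totalDeriv2_apply (f : RT2Coord → ℝ) (z : RT3Coord) :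
    totalDeriv2 f z = fderiv ℝ f (prJet3 z) (1, z.2.2) := rfl

theorem contDiffAt_totalDeriv1 {f : RT1Coord → ℝ} {z : RT2Coord}
    (hf : ContDiffAt ℝ ∞ f (prJet z)) : ContDiffAt ℝ ∞ (totalDeriv1 f) z := by
  have h : ContDiffAt ℝ ∞ (fun z : RT2Coord => fderiv ℝ f (prJet z)) z :=
    (contDiffAt_fderiv hf).comp z prJet.contDiff.contDiffAt
  have h' : ContDiffAt ℝ ∞ (fun z : RT2Coord => ((1, z.2.2) : RT1Coord)) z :=
    contDiffAt_const.prodMk (contDiffAt_snd.comp z contDiffAt_snd)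
  exact h.clm_apply h'

/-- Differentiation along `u` fails to commute with `d/dt = ∂/∂t + v ∂/∂x + a ∂/∂v` exactly by the
derivative of the coefficients `v` and `a`, which is the second summand. -/
theorem fderiv_totalDeriv1 {f : RT1Coord → ℝ} {z : RT2Coord}
    (hf : ContDiffAt ℝ 2 f (prJet z)) (u : RT2Coord) :
    fderiv ℝ (totalDeriv1 f) z u =
      totalDeriv1 (fun y => fderiv ℝ f y (prJet u)) z + fderiv ℝ f (prJet z) (0, u.2.2) := by
  have hd : DifferentiableAt ℝ (fderiv ℝ f) (prJet z) :=
    (hf.fderiv_right (m := 1) (by norm_num)).differentiableAt (by simp)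
  have hc : HasFDerivAt (fun z : RT2Coord => fderiv ℝ f (prJet z))
      ((fderiv ℝ (fderiv ℝ f) (prJet z)).comp prJet) z := hd.hasFDerivAt.comp z prJet.hasFDerivAt
  have hs : HasFDerivAt (fun z : RT2Coord => ((1, z.2.2) : RT1Coord)) _ z :=
    (hasFDerivAt_const (1 : ℝ) z).prodMk ((ContinuousLinearMap.snd ℝ Plane (Plane × Plane)).comp
      (ContinuousLinearMap.snd ℝ ℝ (Plane × Plane × Plane))).hasFDerivAt
  have h := (hc.clm_apply hs).fderiv
  have e1 : fderiv ℝ (totalDeriv1 f) z u = fderiv ℝ f (prJet z) (0, u.2.2)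
      + fderiv ℝ (fderiv ℝ f) (prJet z) (prJet u) (1, z.2.2) :=
    congrArg (fun A : RT2Coord →L[ℝ] ℝ => A u) h
  rw [e1, totalDeriv1_apply, fderiv_clm_apply_const hd,
    (hf.isSymmSndFDerivAt (by simp)).eq, add_comm]

theorem totalDeriv2_comp_prJet {f : RT1Coord → ℝ} {z : RT3Coord}
    (hf : DifferentiableAt ℝ f (prJet (prJet3 z))) :
    totalDeriv2 (fun y => f (prJet y)) z = totalDeriv1 f (prJet3 z) := by
  rw [totalDeriv2_apply, fderiv_comp_clm prJet hf]
  rfl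

/-- `d/dt` of a function of `(t, x, v)` does not contribute to the Euler-Lagrange expressions. -/
theorem eulerLagrange2_totalDeriv1_add {G K : RT1Coord → ℝ} {t : ℝ} {x v : Plane}
    (hG : ContDiffAt ℝ ∞ G (t, x, v)) (hK : ContDiffAt ℝ ∞ K (t, x, v)) (i : Fin 2)
    (a b c : Plane) :
    eulerLagrange2 (fun z => totalDeriv1 G z + K (prJet z)) i (t, x, v, a, b, c)
      = eulerLagrange1 K i (t, x, v, a) := by
  set L : RT2Coord → ℝ := fun z => totalDeriv1 G z + K (prJet z) with hL
  have fL : ∀ z : RT2Coord, ContDiffAt ℝ 2 G (prJet z) → ContDiffAt ℝ 2 K (prJet z) →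
      ∀ u, fderiv ℝ L z u = totalDeriv1 (fun y => fderiv ℝ G y (prJet u)) z
        + fderiv ℝ G (prJet z) (0, u.2.2) + fderiv ℝ K (prJet z) (prJet u) := by
    intro z hGz hKz u
    have hd : DifferentiableAt ℝ (totalDeriv1 G) z := by
      have h : ContDiffAt ℝ 1 (fun z : RT2Coord => fderiv ℝ G (prJet z)) z :=
        (hGz.fderiv_right (m := 1) (by norm_num)).comp z prJet.contDiff.contDiffAt
      have h' : ContDiffAt ℝ 1 (fun z : RT2Coord => ((1, z.2.2) : RT1Coord)) z :=
        contDiffAt_const.prodMk (contDiffAt_snd.comp z contDiffAt_snd)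
      exact (h.clm_apply h').differentiableAt (by simp)
    have hd' : DifferentiableAt ℝ (fun z => K (prJet z)) z :=
      (hKz.differentiableAt (by simp)).comp z prJet.differentiableAt
    have h := congrArg (fun A : RT2Coord →L[ℝ] ℝ => A u) (fderiv_add hd hd')
    have h2 : fderiv ℝ L z u = fderiv ℝ (totalDeriv1 G) z u
      + fderiv ℝ (fun z => K (prJet z)) z u := h
    rw [h2, fderiv_totalDeriv1 hGz, fderiv_comp_clm prJet (hKz.differentiableAt (by simp))]
  have hev : ∀ᶠ y : RT1Coord in 𝓝 (t, x, v), ContDiffAt ℝ 2 G y ∧ ContDiffAt ℝ 2 K y :=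
    (eventually_contDiffAt_two hG).and (eventually_contDiffAt_two hK)
  have hc2 : Filter.Tendsto prJet (𝓝 (t, x, v, a)) (𝓝 (t, x, v)) :=
    prJet.continuous.continuousAt
  have hev2 : ∀ᶠ y : RT2Coord in 𝓝 (t, x, v, a),
      ContDiffAt ℝ 2 G (prJet y) ∧ ContDiffAt ℝ 2 K (prJet y) := hc2.eventually hev
  have hGu : ∀ u, ContDiffAt ℝ ∞ (fun y => fderiv ℝ G y u) (t, x, v) := fun u =>
    contDiffAt_fderiv_apply hG contDiffAt_const
  have hKu : ∀ u, ContDiffAt ℝ ∞ (fun y => fderiv ℝ K y u) (t, x, v) := fun u =>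
    contDiffAt_fderiv_apply hK contDiffAt_const
  set Gx := fun y => fderiv ℝ G y (0, e i, 0) with hGx
  set Gv := fun y => fderiv ℝ G y (0, 0, e i) with hGv
  set Kv := fun y => fderiv ℝ K y (0, 0, e i) with hKv
  -- For the part `dG/dt` of `L`, the derivatives along `x`, `v`, `a` are `d/dt Gx`, `d/dt Gv + Gx`
  -- and `Gv`. Hence its Euler–Lagrange expression is `d/dt Gx - d/dt (d/dt Gv + Gx) + d²/dt² Gv =
  -- 0`.
  have e1 : fderiv ℝ L (t, x, v, a) (0, e i, 0, 0) = totalDeriv1 Gx (t, x, v, a)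
      + fderiv ℝ K (t, x, v) (0, e i, 0) := by
    rw [fL _ hev2.self_of_nhds.1 hev2.self_of_nhds.2]
    have : ((0, ((0, e i, 0, 0) : RT2Coord).2.2) : RT1Coord) = 0 := rfl
    rw [this, map_zero, add_zero]
    rfl
  have e2 : totalDeriv2 (fun w => fderiv ℝ L w (0, 0, e i, 0)) (t, x, v, a, b) =
      totalDeriv2 (totalDeriv1 Gv) (t, x, v, a, b) + totalDeriv1 Gx (t, x, v, a)
        + totalDeriv1 Kv (t, x, v, a) := by
    have h : (fun w => fderiv ℝ L w (0, 0, e i, 0)) =ᶠ[𝓝 (t, x, v, a)]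
        fun w => totalDeriv1 Gv w + (Gx (prJet w) + Kv (prJet w)) := by
      filter_upwards [hev2] with y hy
      rw [fL y hy.1 hy.2, add_assoc]
      rfl
    have d1 : DifferentiableAt ℝ (totalDeriv1 Gv) (t, x, v, a) :=
      differentiableAt_of_contDiffAt (contDiffAt_totalDeriv1 (hGu _))
    have hcomp : ∀ f : RT1Coord → ℝ, DifferentiableAt ℝ f (t, x, v) →
        DifferentiableAt ℝ (fun w => f (prJet w)) (t, x, v, a) := fun f hf =>
      DifferentiableAt.comp (g := f) (f := prJet) (t, x, v, a) hf prJet.differentiableAt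
    have d2 : DifferentiableAt ℝ (fun w => Gx (prJet w)) (t, x, v, a) :=
      hcomp Gx (differentiableAt_of_contDiffAt (hGu _))
    have d3 : DifferentiableAt ℝ (fun w => Kv (prJet w)) (t, x, v, a) :=
      hcomp Kv (differentiableAt_of_contDiffAt (hKu _))
    have hs : fderiv ℝ (fun w => totalDeriv1 Gv w + (Gx (prJet w) + Kv (prJet w))) (t, x, v, a)
        = fderiv ℝ (totalDeriv1 Gv) (t, x, v, a) + (fderiv ℝ (fun w => Gx (prJet w)) (t, x, v, a)
          + fderiv ℝ (fun w => Kv (prJet w)) (t, x, v, a)) := by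
      rw [← fderiv_fun_add d2 d3]
      exact fderiv_fun_add d1 (d2.add d3)
    rw [totalDeriv2_apply, prJet3_apply, h.fderiv_eq, hs, add_assoc, add_apply, add_apply]
    refine congrArg₂ (· + ·) rfl (congrArg₂ (· + ·) ?_ ?_)
    · exact totalDeriv2_comp_prJet (z := (t, x, v, a, b)) (differentiableAt_of_contDiffAt (hGu _))
    · exact totalDeriv2_comp_prJet (z := (t, x, v, a, b)) (differentiableAt_of_contDiffAt (hKu _))
  have e3 : totalDeriv3 (totalDeriv2 (fun w => fderiv ℝ L w (0, 0, 0, e i))) (t, x, v, a, b, c) =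
      totalDeriv2 (totalDeriv1 Gv) (t, x, v, a, b) := by
    have h : (fun w => fderiv ℝ L w (0, 0, 0, e i)) =ᶠ[𝓝 (t, x, v, a)]
        fun w => Gv (prJet w) := by
      filter_upwards [hev2] with y hy
      rw [fL y hy.1 hy.2]
      have h0 : prJet (0, 0, 0, e i) = 0 := rfl
      rw [h0]
      simp [totalDeriv1_apply, hGv]
    -- Since `∂L/∂a = Gv` depends on `(t, x, v)` only, its total derivative does not involve `b`.
    -- The outer total derivative then does not involve `c`.
    have h' : totalDeriv2 (fun w => fderiv ℝ L w (0, 0, 0, e i)) =ᶠ[𝓝 (t, x, v, a, b)]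
        fun z => totalDeriv1 Gv (prJet3 z) := by
      have hc : Filter.Tendsto prJet3 (𝓝 (t, x, v, a, b)) (𝓝 (t, x, v, a)) :=
        prJet3.continuous.continuousAt
      have hGv2 : ∀ᶠ y : RT1Coord in 𝓝 (t, x, v), ContDiffAt ℝ 2 Gv y :=
        eventually_contDiffAt_two (hGu _)
      filter_upwards [hc.eventually h.eventuallyEq_nhds,
        hc.eventually (hc2.eventually hGv2)] with z hz hz'
      rw [totalDeriv2_apply, hz.fderiv_eq, ← totalDeriv2_apply]
      exact totalDeriv2_comp_prJet (hz'.differentiableAt (by simp))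
    change fderiv ℝ _ (t, x, v, a, b) (1, v, a, b, c) = _
    rw [h'.fderiv_eq, fderiv_comp_clm prJet3
      (differentiableAt_of_contDiffAt (contDiffAt_totalDeriv1 (hGu _)))]
    rfl
  change fderiv ℝ L (t, x, v, a) (0, e i, 0, 0)
    - totalDeriv2 (fun w => fderiv ℝ L w (0, 0, e i, 0)) (t, x, v, a, b)
    + totalDeriv3 (totalDeriv2 (fun w => fderiv ℝ L w (0, 0, 0, e i))) (t, x, v, a, b, c)
    = fderiv ℝ K (t, x, v) (0, e i, 0) - totalDeriv1 Kv (t, x, v, a)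
  rw [e1, e2, e3]
  ring

theorem eulerLagrange2_congr {L L' : RT2Coord → ℝ} {t : ℝ} {x v a : Plane}
    (h : L =ᶠ[𝓝 (t, x, v, a)] L') (i : Fin 2) (b c : Plane) :
    eulerLagrange2 L i (t, x, v, a, b, c) = eulerLagrange2 L' i (t, x, v, a, b, c) := by
  have hu : ∀ u, (fun w => fderiv ℝ L w u) =ᶠ[𝓝 (t, x, v, a)] fun w => fderiv ℝ L' w u :=
    fun u => h.fderiv.fun_comp fun A : RT2Coord →L[ℝ] ℝ => A u
  have hT : ∀ u, totalDeriv2 (fun w => fderiv ℝ L w u) =ᶠ[𝓝 (t, x, v, a, b)]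
      totalDeriv2 (fun w => fderiv ℝ L' w u) := fun u => by
    have hc : Filter.Tendsto prJet3 (𝓝 (t, x, v, a, b)) (𝓝 (t, x, v, a)) :=
      prJet3.continuous.continuousAt
    filter_upwards [hc.eventually (hu u).eventuallyEq_nhds] with z hz
    rw [totalDeriv2_apply, totalDeriv2_apply, hz.fderiv_eq]
  change fderiv ℝ L (t, x, v, a) (0, e i, 0, 0)
    - totalDeriv2 (fun w => fderiv ℝ L w (0, 0, e i, 0)) (t, x, v, a, b)
    + fderiv ℝ (totalDeriv2 (fun w => fderiv ℝ L w (0, 0, 0, e i))) (t, x, v, a, b)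
      (1, v, a, b, c) = fderiv ℝ L' (t, x, v, a) (0, e i, 0, 0)
    - totalDeriv2 (fun w => fderiv ℝ L' w (0, 0, e i, 0)) (t, x, v, a, b)
    + fderiv ℝ (totalDeriv2 (fun w => fderiv ℝ L' w (0, 0, 0, e i))) (t, x, v, a, b)
      (1, v, a, b, c)
  rw [h.fderiv_eq, (hT _).self_of_nhds, (hT _).fderiv_eq]

theorem eulerLagrange1_eq {L : RT1Coord → ℝ} {t : ℝ} {x v : Plane}
    (hL : ContDiffAt ℝ ∞ L (t, x, v)) (i : Fin 2) (a : Plane) :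
    eulerLagrange1 L i (t, x, v, a) = fderiv ℝ L (t, x, v) (0, e i, 0)
      - fderiv ℝ (fderiv ℝ L) (t, x, v) (1, v, a) (0, 0, e i) := by
  rw [← fderiv_fderiv_apply_const hL]
  rfl

theorem eulerLagrange1_congr {L L' : RT1Coord → ℝ} {t : ℝ} {x v : Plane}
    (h : L =ᶠ[𝓝 (t, x, v)] L') (i : Fin 2) (a : Plane) :
    eulerLagrange1 L i (t, x, v, a) = eulerLagrange1 L' i (t, x, v, a) := by
  have hu : ∀ u, (fun w => fderiv ℝ L w u) =ᶠ[𝓝 (t, x, v)] fun w => fderiv ℝ L' w u :=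
    fun u => h.fderiv.fun_comp fun A : RT1Coord →L[ℝ] ℝ => A u
  change fderiv ℝ L (t, x, v) (0, e i, 0) - fderiv ℝ _ (t, x, v) (1, v, a) =
    fderiv ℝ L' (t, x, v) (0, e i, 0) - fderiv ℝ _ (t, x, v) (1, v, a)
  rw [h.fderiv_eq, (hu _).fderiv_eq]

theorem eulerLagrange1_add {L L' : RT1Coord → ℝ} {t : ℝ} {x v : Plane}
    (hL : ContDiffAt ℝ ∞ L (t, x, v)) (hL' : ContDiffAt ℝ ∞ L' (t, x, v)) (i : Fin 2)
    (a : Plane) : eulerLagrange1 (fun z => L z + L' z) i (t, x, v, a)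
      = eulerLagrange1 L i (t, x, v, a) + eulerLagrange1 L' i (t, x, v, a) := by
  have h2 : fderiv ℝ (fun z => L z + L' z) =ᶠ[𝓝 (t, x, v)]
      fun z => fderiv ℝ L z + fderiv ℝ L' z := by
    filter_upwards [eventually_contDiffAt_two hL, eventually_contDiffAt_two hL'] with y hy hy'
    exact fderiv_fun_add (hy.differentiableAt (by simp)) (hy'.differentiableAt (by simp))
  rw [eulerLagrange1_eq (hL.add hL'), eulerLagrange1_eq hL, eulerLagrange1_eq hL',
    h2.fderiv_eq, h2.self_of_nhds,
    fderiv_fun_add (differentiableAt_of_contDiffAt (contDiffAt_fderiv hL))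
      (differentiableAt_of_contDiffAt (contDiffAt_fderiv hL'))]
  simp only [add_apply]
  ring

/-- The total derivative of a function of `(t, x)` is a null Lagrangian. -/
theorem eulerLagrange1_fderiv_apply {g : ℝ × Plane → ℝ} {t : ℝ} {x : Plane}
    (hg : ContDiffAt ℝ ∞ g (t, x)) (i : Fin 2) (v a : Plane) :
    eulerLagrange1 (fun z => fderiv ℝ g (z.1, z.2.1) (1, z.2.2)) i (t, x, v, a) = 0 := by
  set q : RT1Coord →L[ℝ] ℝ × Plane := (ContinuousLinearMap.fst ℝ ℝ (Plane × Plane)).prod prBase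
    with hq
  have hf : ∀ z : RT1Coord, ContDiffAt ℝ 2 g (q z) → ∀ u,
      fderiv ℝ (fun z : RT1Coord => fderiv ℝ g (z.1, z.2.1) (1, z.2.2)) z u =
        fderiv ℝ (fderiv ℝ g) (q z) (q u) (1, z.2.2) + fderiv ℝ g (q z) (0, u.2.2) := by
    intro z hz u
    have hc : HasFDerivAt (fun z => fderiv ℝ g (q z)) ((fderiv ℝ (fderiv ℝ g) (q z)).comp q) z :=
      ((hz.fderiv_right (m := 1) (by norm_num)).differentiableAt (by simp)).hasFDerivAt.comp z
        q.hasFDerivAt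
    have hs : HasFDerivAt (fun z : RT1Coord => ((1, z.2.2) : ℝ × Plane)) _ z :=
      (hasFDerivAt_const (1 : ℝ) z).prodMk ((ContinuousLinearMap.snd ℝ Plane Plane).comp
        prTangent).hasFDerivAt
    have h := congrArg (fun A : RT1Coord →L[ℝ] ℝ => A u) (hc.clm_apply hs).fderiv
    rw [add_comm]
    exact h
  have hc : Filter.Tendsto q (𝓝 (t, x, v)) (𝓝 (t, x)) := q.continuous.continuousAt
  have hev : ∀ᶠ z in 𝓝 ((t, x, v) : RT1Coord), ContDiffAt ℝ 2 g (q z) :=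
    hc.eventually (eventually_contDiffAt_two hg)
  have hv : (fun z => fderiv ℝ (fun z : RT1Coord => fderiv ℝ g (z.1, z.2.1) (1, z.2.2)) z
      (0, 0, e i)) =ᶠ[𝓝 (t, x, v)] fun z => fderiv ℝ g (q z) (0, e i) := by
    filter_upwards [hev] with z hz
    have h0 : q (0, 0, e i) = 0 := rfl
    rw [hf z hz, h0]
    simp
  change fderiv ℝ _ (t, x, v) (0, e i, 0) - fderiv ℝ _ (t, x, v) (1, v, a) = 0
  rw [hf _ hev.self_of_nhds, hv.fderiv_eq,
    fderiv_comp_clm (f := fun y => fderiv ℝ g y (0, e i)) q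
      (hasFDerivAt_clm_apply_const (differentiableAt_of_contDiffAt (contDiffAt_fderiv hg))
        (0, e i)).differentiableAt]
  -- By `hv`, the momentum of `dg/dt` is `∂g/∂x`; what is left is the symmetry of the second
  -- derivative of `g`.
  have e1 := fderiv_fderiv_apply_const hg (1, v) (0, e i)
  have e2 := fderiv_fderiv_comm hg (1, v) (0, e i)
  have h0 : ((0, ((0, e i, 0) : RT1Coord).2.2) : ℝ × Plane) = 0 := rfl
  rw [h0, map_zero, add_zero]
  change fderiv ℝ (fderiv ℝ g) (t, x) (0, e i) (1, v)
    - fderiv ℝ (fun y => fderiv ℝ g y (0, e i)) (t, x) (1, v) = 0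
  rw [e1, e2, sub_self]

end TotalDerivative


/-! ## Autonomous Lagrangians -/

section Autonomous

/-- The Euler-Lagrange expression `∂l/∂x · w - d/dt (∂l/∂v · w)` of a function `l(x, v)`. -/
def autonomousEL (l : TCoord → ℝ) (z : TCoord) (a w : Plane) : ℝ :=
  fderiv ℝ l z (w, 0) - fderiv ℝ (fderiv ℝ l) z (z.2, a) (0, w)

/-- The energy `∂l/∂v · v - l`. -/
def energy (l : TCoord → ℝ) (z : TCoord) : ℝ := fderiv ℝ l z (0, z.2) - l z

/-- The momentum `∂l/∂v`. -/
def momentum (l : TCoord → ℝ) (z : TCoord) : Plane →L[ℝ] ℝ :=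
  (fderiv ℝ l z).comp (ContinuousLinearMap.inr ℝ Plane Plane)

variable {l l' : TCoord → ℝ} {z : TCoord}

@[simp]
theorem momentum_apply (l : TCoord → ℝ) (z : TCoord) (w : Plane) :
    momentum l z w = fderiv ℝ l z (0, w) := rfl

theorem autonomousEL_add (hl : ContDiffAt ℝ ∞ l z) (hl' : ContDiffAt ℝ ∞ l' z) (a w : Plane) :
    autonomousEL (fun y => l y + l' y) z a w = autonomousEL l z a w + autonomousEL l' z a w := by
  have h2 : fderiv ℝ (fun y => l y + l' y) =ᶠ[𝓝 z] fun y => fderiv ℝ l y + fderiv ℝ l' y := by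
    filter_upwards [eventually_contDiffAt_two hl, eventually_contDiffAt_two hl'] with y hy hy'
    exact fderiv_fun_add (hy.differentiableAt (by simp)) (hy'.differentiableAt (by simp))
  simp only [autonomousEL]
  rw [h2.fderiv_eq, h2.self_of_nhds,
    fderiv_fun_add (differentiableAt_of_contDiffAt (contDiffAt_fderiv hl))
      (differentiableAt_of_contDiffAt (contDiffAt_fderiv hl'))]
  simp only [add_apply]
  ring

/-- The coefficients `εᵢ` only see `w = e i`; linearity in `w` gives access to the images of these
vectors under a change of coordinates. -/
theorem autonomousEL_eq_sum (l : TCoord → ℝ) (z : TCoord) (a w : Plane) :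
    autonomousEL l z a w = w 0 * autonomousEL l z a (e 0) + w 1 * autonomousEL l z a (e 1) := by
  have h := map_plane (((fderiv ℝ l z).comp (ContinuousLinearMap.inl ℝ Plane Plane) -
    (fderiv ℝ (fderiv ℝ l) z (z.2, a)).comp (ContinuousLinearMap.inr ℝ Plane Plane) :
      Plane →L[ℝ] ℝ) : Plane →ₗ[ℝ] ℝ) w
  exact h

theorem autonomousEL_affine (l : TCoord → ℝ) (z : TCoord) (a w : Plane) :
    autonomousEL l z a w =
      autonomousEL l z 0 w - fderiv ℝ (fderiv ℝ l) z (0, a) (0, w) := by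
  have : ((z.2, a) : TCoord) = (z.2, 0) + (0, a) := by simp
  rw [autonomousEL, autonomousEL, this, map_add, add_apply]
  ring

theorem eulerLagrange1_comp_prTangent {x v : Plane} (hl : ContDiffAt ℝ ∞ l (x, v)) (i : Fin 2)
    (t : ℝ) (a : Plane) :
    eulerLagrange1 (fun z => l (prTangent z)) i (t, x, v, a) = autonomousEL l (x, v) a (e i) := by
  have hl' : ContDiffAt ℝ ∞ (fun z : RT1Coord => l (prTangent z)) (t, x, v) :=
    ContDiffAt.comp (g := l) (t, x, v) hl prTangent.contDiff.contDiffAt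
  rw [eulerLagrange1_eq hl', fderiv_comp_clm prTangent (differentiableAt_of_contDiffAt hl),
    fderiv_fderiv_comp_clm prTangent hl]
  rfl

theorem contDiffAt_gyroscopic {β : Plane → Plane →L[ℝ] ℝ} {z : TCoord}
    (hβ : ContDiffAt ℝ ∞ β z.1) : ContDiffAt ℝ ∞ (fun z : TCoord => β z.1 z.2) z :=
  (hβ.comp z contDiffAt_fst).clm_apply contDiffAt_snd

/-- The momentum of `β(x)(v)` is `β(x)`, which does not involve the velocity, so no acceleration
appears. The result is `dβ(w, v)`; in particular a closed `β` contributes nothing. -/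
theorem autonomousEL_gyroscopic {β : Plane → Plane →L[ℝ] ℝ} {z : TCoord}
    (hβ : ContDiffAt ℝ ∞ β z.1) (a w : Plane) :
    autonomousEL (fun z => β z.1 z.2) z a w = fderiv ℝ β z.1 w z.2 - fderiv ℝ β z.1 z.2 w := by
  have hf : ∀ y : TCoord, DifferentiableAt ℝ β y.1 → ∀ u,
      fderiv ℝ (fun z : TCoord => β z.1 z.2) y u = fderiv ℝ β y.1 u.1 y.2 + β y.1 u.2 := by
    intro y hy u
    have hc : HasFDerivAt (fun z : TCoord => β z.1)
        ((fderiv ℝ β y.1).comp (ContinuousLinearMap.fst ℝ Plane Plane)) y :=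
      hy.hasFDerivAt.comp y hasFDerivAt_fst
    have h := congrArg (fun A : TCoord →L[ℝ] ℝ => A u) (hc.clm_apply hasFDerivAt_snd).fderiv
    rw [add_comm]
    exact h
  have hc : Filter.Tendsto Prod.fst (𝓝 z) (𝓝 z.1) := continuous_fst.continuousAt
  have hev : ∀ᶠ y : TCoord in 𝓝 z, ContDiffAt ℝ 2 β y.1 :=
    hc.eventually (eventually_contDiffAt_two hβ)
  have hv : (fun y => fderiv ℝ (fun z : TCoord => β z.1 z.2) y (0, w)) =ᶠ[𝓝 z]
      fun y => β y.1 w := by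
    filter_upwards [hev] with y hy
    rw [hf y (hy.differentiableAt (by simp))]
    simp
  have hd := differentiableAt_of_contDiffAt hβ
  rw [autonomousEL, ← fderiv_fderiv_apply_const (contDiffAt_gyroscopic hβ), hv.fderiv_eq,
    hf z hd]
  have h0 : fderiv ℝ (fun y : TCoord => β y.1 w) z (z.2, a) = fderiv ℝ (fun x => β x w) z.1 z.2 :=
    fderiv_comp_clm (f := fun x => β x w) (ContinuousLinearMap.fst ℝ Plane Plane)
      (hasFDerivAt_clm_apply_const hd w).differentiableAt (z.2, a)
  have h1 := fderiv_clm_apply_const hd w z.2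
  change fderiv ℝ β z.1 w z.2 + β z.1 0 - _ = _
  rw [h0, h1, map_zero, add_zero]

theorem autonomousEL_potential {m : Plane → ℝ} {z : TCoord}
    (hm : ContDiffAt ℝ ∞ m z.1) (a w : Plane) :
    autonomousEL (fun z => m z.1) z a w = fderiv ℝ m z.1 w := by
  have h1 := fderiv_comp_clm (ContinuousLinearMap.fst ℝ Plane Plane) (z := z)
    (differentiableAt_of_contDiffAt hm) (w, 0)
  have h2 := fderiv_fderiv_comp_clm (ContinuousLinearMap.fst ℝ Plane Plane) (z := z) hm
    (z.2, a) (0, w)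
  refine (congrArg₂ (· - ·) h1 h2).trans ?_
  simp

theorem contDiffAt_momentum (hl : ContDiffAt ℝ ∞ l z) : ContDiffAt ℝ ∞ (momentum l) z :=
  (contDiffAt_fderiv hl).clm_comp contDiffAt_const

theorem contDiffAt_energy (hl : ContDiffAt ℝ ∞ l z) : ContDiffAt ℝ ∞ (energy l) z :=
  (contDiffAt_fderiv_apply hl (contDiffAt_const.prodMk contDiffAt_snd)).sub hl

/-- The terms `∂l/∂v · u.2` from the product rule and from `-dl` cancel. -/
theorem fderiv_energy (hl : ContDiffAt ℝ ∞ l z) (u : TCoord) :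
    fderiv ℝ (energy l) z u =
      fderiv ℝ (fderiv ℝ l) z u (0, z.2) - fderiv ℝ l z (u.1, 0) := by
  have hd := differentiableAt_of_contDiffAt (contDiffAt_fderiv hl)
  have hs : HasFDerivAt (fun z : TCoord => ((0, z.2) : TCoord)) _ z :=
    (hasFDerivAt_const (0 : Plane) z).prodMk (ContinuousLinearMap.snd ℝ Plane Plane).hasFDerivAt
  have h1 := (hd.hasFDerivAt.clm_apply hs).sub (differentiableAt_of_contDiffAt hl).hasFDerivAt
  have h2 : fderiv ℝ (energy l) z u = _ := congrArg (fun A : TCoord →L[ℝ] ℝ => A u) h1.fderiv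
  have h3 : fderiv ℝ (energy l) z u = fderiv ℝ l z (0, u.2)
      + fderiv ℝ (fderiv ℝ l) z u (0, z.2) - fderiv ℝ l z u := h2
  have h4 : fderiv ℝ l z u = fderiv ℝ l z (u.1, 0) + fderiv ℝ l z (0, u.2) := by
    rw [← map_add]; simp
  rw [h3, h4]
  ring

/-! ### Naturality of momentum, energy and Euler–Lagrange expressions -/

section Lift

variable {Φ : Plane → Plane}

theorem contDiffAt_comp_lift (hΦ : ContDiffAt ℝ ∞ Φ z.1)
    (hl : ContDiffAt ℝ ∞ l (tangent.lift Φ z)) : ContDiffAt ℝ ∞ (l ∘ tangent.lift Φ) z :=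
  hl.comp z (contDiffAt_tangent_lift hΦ)

theorem differentiableAt_tangent_lift (hΦ : ContDiffAt ℝ 2 Φ z.1) :
    DifferentiableAt ℝ (tangent.lift Φ) z := by
  have h : ContDiffAt ℝ 1 (tangent.lift Φ) z :=
    ((hΦ.of_le (by norm_num)).comp z contDiffAt_fst).prodMk
      (((hΦ.fderiv_right (m := 1) (by norm_num)).comp z contDiffAt_fst).clm_apply contDiffAt_snd)
  exact h.differentiableAt (by simp)

theorem fderiv_comp_lift (hΦ : ContDiffAt ℝ 2 Φ z.1)
    (hl : DifferentiableAt ℝ l (tangent.lift Φ z)) (u : TCoord) :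
    fderiv ℝ (l ∘ tangent.lift Φ) z u = fderiv ℝ l (tangent.lift Φ z)
      (fderiv ℝ Φ z.1 u.1, fderiv ℝ (fderiv ℝ Φ) z.1 u.1 z.2 + fderiv ℝ Φ z.1 u.2) := by
  rw [fderiv_comp z hl (differentiableAt_tangent_lift hΦ), ContinuousLinearMap.comp_apply,
    fderiv_tangent_lift hΦ]

theorem momentum_comp_lift (hΦ : ContDiffAt ℝ 2 Φ z.1)
    (hl : DifferentiableAt ℝ l (tangent.lift Φ z)) :
    momentum (l ∘ tangent.lift Φ) z =
      (momentum l (tangent.lift Φ z)).comp (fderiv ℝ Φ z.1) := by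
  ext w
  simp [fderiv_comp_lift hΦ hl]

/-- The lift of `Φ` is linear on the fibres, so it preserves the derivative in the direction `(0,
v)` at `(x, v)`. -/
theorem energy_comp_lift (hΦ : ContDiffAt ℝ 2 Φ z.1)
    (hl : DifferentiableAt ℝ l (tangent.lift Φ z)) :
    energy (l ∘ tangent.lift Φ) z = energy l (tangent.lift Φ z) := by
  simp only [energy, fderiv_comp_lift hΦ hl, Function.comp_apply, map_zero, zero_apply, zero_add]
  rfl

/-- The Euler-Lagrange expressions are natural under changes of coordinates. -/
theorem autonomousEL_comp_lift (hΦ : ContDiffAt ℝ ∞ Φ z.1)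
    (hl : ContDiffAt ℝ ∞ l (tangent.lift Φ z)) (a w : Plane) :
    autonomousEL (l ∘ tangent.lift Φ) z a w =
      autonomousEL l (tangent.lift Φ z)
        (fderiv ℝ (fderiv ℝ Φ) z.1 z.2 z.2 + fderiv ℝ Φ z.1 a) (fderiv ℝ Φ z.1 w) := by
  have hΦ2 : ∀ᶠ y : TCoord in 𝓝 z, ContDiffAt ℝ 2 Φ y.1 :=
    (continuous_fst.continuousAt : Filter.Tendsto Prod.fst (𝓝 z) (𝓝 z.1)).eventually
      (eventually_contDiffAt_two hΦ)
  have hT : DifferentiableAt ℝ (tangent.lift Φ) z :=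
    differentiableAt_tangent_lift hΦ2.self_of_nhds
  have hl2 : ∀ᶠ y : TCoord in 𝓝 z, ContDiffAt ℝ 2 l (tangent.lift Φ y) :=
    hT.continuousAt.eventually (eventually_contDiffAt_two hl)
  have hv : (fun y => fderiv ℝ (l ∘ tangent.lift Φ) y (0, w)) =ᶠ[𝓝 z]
      fun y => fderiv ℝ l (tangent.lift Φ y) (0, fderiv ℝ Φ y.1 w) := by
    filter_upwards [hΦ2, hl2] with y hy hy'
    rw [fderiv_comp_lift hy (hy'.differentiableAt (by simp))]
    simp
  have hd := differentiableAt_of_contDiffAt (contDiffAt_fderiv hl)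
  have hc : HasFDerivAt (fun y => fderiv ℝ l (tangent.lift Φ y))
      ((fderiv ℝ (fderiv ℝ l) (tangent.lift Φ z)).comp (fderiv ℝ (tangent.lift Φ) z)) z :=
    hd.hasFDerivAt.comp z hT.hasFDerivAt
  have hp : HasFDerivAt (fun y : TCoord => fderiv ℝ Φ y.1 w)
      (((fderiv ℝ (fderiv ℝ Φ) z.1).flip w).comp (ContinuousLinearMap.fst ℝ Plane Plane)) z :=
    (hasFDerivAt_clm_apply_const
      (differentiableAt_of_contDiffAt (contDiffAt_fderiv hΦ)) w).comp z hasFDerivAt_fst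
  have hs : HasFDerivAt (fun y : TCoord => ((0, fderiv ℝ Φ y.1 w) : TCoord)) _ z :=
    (hasFDerivAt_const (0 : Plane) z).prodMk hp
  have h1 : fderiv ℝ (fun y => fderiv ℝ l (tangent.lift Φ y) (0, fderiv ℝ Φ y.1 w)) z (z.2, a)
      = fderiv ℝ l (tangent.lift Φ z) (0, fderiv ℝ (fderiv ℝ Φ) z.1 z.2 w)
        + fderiv ℝ (fderiv ℝ l) (tangent.lift Φ z) (fderiv ℝ (tangent.lift Φ) z (z.2, a))
          (0, fderiv ℝ Φ z.1 w) :=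
    congrArg (fun A : TCoord →L[ℝ] ℝ => A (z.2, a)) (hc.clm_apply hs).fderiv
  -- The non-tensorial term `∂l/∂v · D²Φ(v, w)` appears both in `∂/∂x` and in `d/dt ∂/∂v`. By the
  -- symmetry of `D²Φ` the two occurrences cancel.
  have h2 : fderiv ℝ l (tangent.lift Φ z)
      (fderiv ℝ Φ z.1 w, fderiv ℝ (fderiv ℝ Φ) z.1 w z.2 + fderiv ℝ Φ z.1 0) =
      fderiv ℝ l (tangent.lift Φ z) (fderiv ℝ Φ z.1 w, 0) +
      fderiv ℝ l (tangent.lift Φ z) (0, fderiv ℝ (fderiv ℝ Φ) z.1 z.2 w) := by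
    rw [← map_add, fderiv_fderiv_comm hΦ w z.2]
    simp
  rw [autonomousEL, ← fderiv_fderiv_apply_const (contDiffAt_comp_lift hΦ hl), hv.fderiv_eq, h1,
    fderiv_comp_lift hΦ2.self_of_nhds (differentiableAt_of_contDiffAt hl),
    fderiv_tangent_lift hΦ2.self_of_nhds, h2]
  change _ = fderiv ℝ l (tangent.lift Φ z) (fderiv ℝ Φ z.1 w, 0)
    - fderiv ℝ (fderiv ℝ l) (tangent.lift Φ z) (fderiv ℝ Φ z.1 z.2, _) (0, fderiv ℝ Φ z.1 w)
  ring

end Lift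

end Autonomous


/-! ## Local autonomous Lagrangians of a source form -/

section LocalLagrangian

variable {M : Type*} [TopologicalSpace M]

/-- The function `l(x, v)`, `x ∈ U`, is a smooth local Lagrangian of `ε` in the chart `φ`. -/
structure IsAutonomousLagrangian (ε : FormFamily M RT2Coord 2) (φ : OpenPartialHomeomorph M Plane)
    (U : Set Plane) (l : TCoord → ℝ) : Prop where
  isOpen : IsOpen U
  subset_target : U ⊆ φ.target
  contDiffAt : ∀ z : TCoord, z.1 ∈ U → ContDiffAt ℝ ∞ l z
  coeff_eq : ∀ (i : Fin 2) (t : ℝ) (x v a : Plane), x ∈ U →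
    coeff ε φ i (t, x, v, a) = autonomousEL l (x, v) a (e i)

theorem fderiv_eq_zero_of_eventually_const {E F : Type*} [NormedAddCommGroup E] [NormedSpace ℝ E]
    [NormedAddCommGroup F] [NormedSpace ℝ F] {f : ℝ × E → F} {t : ℝ} {q : E}
    (hf : DifferentiableAt ℝ f (t, q)) (h : ∀ᶠ s in 𝓝 t, f (s, q) = f (t, q)) :
    fderiv ℝ f (t, q) (1, 0) = 0 := by
  have h1 : HasDerivAt (fun s : ℝ => (s, q)) ((1 : ℝ), (0 : E)) t :=
    (hasDerivAt_id t).prodMk (hasDerivAt_const t q)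
  have h2 : HasDerivAt (fun s : ℝ => f (s, q)) (fderiv ℝ f (t, q) (1, 0)) t :=
    HasFDerivAt.comp_hasDerivAt (l := f) (f := fun s : ℝ => (s, q)) t hf.hasFDerivAt h1
  have h3 : (fun s : ℝ => f (s, q)) =ᶠ[𝓝 t] fun _ => f (t, q) := h
  exact (h2.congr_of_eventuallyEq h3.symm).unique (hasDerivAt_const t _)

theorem fderiv_slice {f : RT1Coord → ℝ} {t : ℝ} {x v : Plane}
    (hf : DifferentiableAt ℝ f (t, x, v)) (u : Plane) :
    fderiv ℝ (fun v => f (t, x, v)) v u = fderiv ℝ f (t, x, v) (0, 0, u) := by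
  have h0 : HasFDerivAt (fun v : Plane => ((x, v) : TCoord)) _ v :=
    (hasFDerivAt_const (𝕜 := ℝ) x v).prodMk (hasFDerivAt_id v)
  have h1 : HasFDerivAt (fun v : Plane => ((t, x, v) : RT1Coord)) _ v :=
    (hasFDerivAt_const t v).prodMk h0
  have h2 := HasFDerivAt.comp (g := f) (f := fun v : Plane => ((t, x, v) : RT1Coord)) v
    hf.hasFDerivAt h1
  exact congrArg (fun A : Plane →L[ℝ] ℝ => A u) h2.fderiv

/-! ### Removing the time from a local Lagrangian -/

section Autonomization

variable {L : RT1Coord → ℝ} {J : Set ℝ} {T : Set Plane}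

/-- `∂L/∂x · w - d/dt (∂L/∂v · w)` for a function `L(t, x, v)`. -/
def timeEL (L : RT1Coord → ℝ) (z : RT1Coord) (a w : Plane) : ℝ :=
  fderiv ℝ L z (0, w, 0) - fderiv ℝ (fderiv ℝ L) z (1, z.2.2, a) (0, 0, w)

theorem timeEL_eq_sum (L : RT1Coord → ℝ) (z : RT1Coord) (a w : Plane) :
    timeEL L z a w = w 0 * timeEL L z a (e 0) + w 1 * timeEL L z a (e 1) := by
  have h := map_plane (((fderiv ℝ L z).comp ((ContinuousLinearMap.inr ℝ ℝ (Plane × Plane)).comp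
      (ContinuousLinearMap.inl ℝ Plane Plane)) -
    (fderiv ℝ (fderiv ℝ L) z (1, z.2.2, a)).comp ((ContinuousLinearMap.inr ℝ ℝ (Plane × Plane)).comp
      (ContinuousLinearMap.inr ℝ Plane Plane)) : Plane →L[ℝ] ℝ) : Plane →ₗ[ℝ] ℝ) w
  exact h

/-- If the Euler-Lagrange expressions of `L` do not depend on time, neither does `∂²L/∂v∂v`. -/
theorem time_vertical_vertical_eq_zero
    (hJ : IsOpen J) (hL : ∀ z : RT1Coord, z.1 ∈ J → z.2.1 ∈ T → ContDiffAt ℝ ∞ L z)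
    (hE : ∀ t ∈ J, ∀ s ∈ J, ∀ x ∈ T, ∀ v a w, timeEL L (t, x, v) a w = timeEL L (s, x, v) a w)
    {t : ℝ} (ht : t ∈ J) {x : Plane} (hx : x ∈ T) (v u w : Plane) :
    fderiv ℝ (fderiv ℝ (fderiv ℝ L)) (t, x, v) (1, 0) (0, 0, u) (0, 0, w) = 0 := by
  have hz := hL (t, x, v) ht hx
  have hd := differentiableAt_of_contDiffAt (contDiffAt_fderiv (contDiffAt_fderiv hz))
  have hd1 := (hasFDerivAt_clm_apply_const hd (0, 0, u)).differentiableAt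
  rw [← fderiv_clm_apply_const hd, ← fderiv_clm_apply_const hd1]
  refine fderiv_eq_zero_of_eventually_const
    (hasFDerivAt_clm_apply_const hd1 (0, 0, w)).differentiableAt ?_
  -- The Euler–Lagrange expression is affine in the acceleration with linear part `-∂²L/∂v∂v`, which
  -- is isolated by comparing the accelerations `0` and `u`.
  have key : ∀ s, fderiv ℝ (fderiv ℝ L) (s, x, v) (0, 0, u) (0, 0, w) =
      timeEL L (s, x, v) 0 w - timeEL L (s, x, v) u w := by
    intro s
    have : ((1, v, u) : RT1Coord) = (1, v, 0) + (0, 0, u) := by simp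
    simp only [timeEL]
    rw [this, map_add, add_apply]
    ring
  filter_upwards [hJ.mem_nhds ht] with s hs
  rw [key, key, hE s hs t ht x hx, hE s hs t ht x hx]

/-- If the Euler-Lagrange expressions of `L` do not depend on time, then `∂²L/∂t∂v` does not depend
on the velocity. -/
theorem time_vertical_eq
    (hJ : IsOpen J) (hL : ∀ z : RT1Coord, z.1 ∈ J → z.2.1 ∈ T → ContDiffAt ℝ ∞ L z)
    (hE : ∀ t ∈ J, ∀ s ∈ J, ∀ x ∈ T, ∀ v a w, timeEL L (t, x, v) a w = timeEL L (s, x, v) a w)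
    {t : ℝ} (ht : t ∈ J) {x : Plane} (hx : x ∈ T) (v w : Plane) :
    fderiv ℝ (fderiv ℝ L) (t, x, v) (1, 0) (0, 0, w) =
      fderiv ℝ (fderiv ℝ L) (t, x, 0) (1, 0) (0, 0, w) := by
  have hd : ∀ v, DifferentiableAt ℝ (fderiv ℝ (fderiv ℝ L)) (t, x, v) := fun v =>
    differentiableAt_of_contDiffAt (contDiffAt_fderiv (contDiffAt_fderiv (hL (t, x, v) ht hx)))
  have hd1 := fun v => (hasFDerivAt_clm_apply_const (hd v) (1, 0)).differentiableAt
  have hd2 := fun v => (hasFDerivAt_clm_apply_const (hd1 v) (0, 0, w)).differentiableAt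
  -- The whole velocity plane over `x` is available, and along it the derivative is `∂³L/∂v∂t∂v =
  -- 0`.
  refine is_const_of_fderiv_eq_zero (𝕜 := ℝ)
    (f := fun v => fderiv ℝ (fderiv ℝ L) (t, x, v) (1, 0) (0, 0, w)) ?_ ?_ v 0
  · intro v
    exact (hd2 v).comp (f := fun v : Plane => ((t, x, v) : RT1Coord)) v
      ((differentiableAt_const t).prodMk ((differentiableAt_const x).prodMk differentiableAt_id))
  · intro v
    ext u
    rw [fderiv_slice (f := fun z => fderiv ℝ (fderiv ℝ L) z (1, 0) (0, 0, w)) (hd2 v) u,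
      fderiv_clm_apply_const (hd1 v), fderiv_clm_apply_const (hd v),
      fderiv_fderiv_fderiv_comm_left (hL (t, x, v) ht hx),
      time_vertical_vertical_eq_zero hJ hL hE ht hx]
    rfl

/-- If the Euler-Lagrange expressions of `L` do not depend on time, then the 1-form `∂²L/∂t∂v dx` is
closed. -/
theorem time_horizontal_vertical_comm
    (hJ : IsOpen J) (hL : ∀ z : RT1Coord, z.1 ∈ J → z.2.1 ∈ T → ContDiffAt ℝ ∞ L z)
    (hE : ∀ t ∈ J, ∀ s ∈ J, ∀ x ∈ T, ∀ v a w, timeEL L (t, x, v) a w = timeEL L (s, x, v) a w)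
    {t : ℝ} (ht : t ∈ J) {x : Plane} (hx : x ∈ T) (v u w : Plane) :
    fderiv ℝ (fderiv ℝ (fderiv ℝ L)) (t, x, v) (1, 0) (0, u, 0) (0, 0, w) =
      fderiv ℝ (fderiv ℝ (fderiv ℝ L)) (t, x, v) (1, 0) (0, w, 0) (0, 0, u) := by
  have hdz := fun s (hs : s ∈ J) => differentiableAt_of_contDiffAt
    (contDiffAt_fderiv (contDiffAt_fderiv (hL (s, x, v) hs hx)))
  have hs : ∀ z : RT1Coord, HasFDerivAt (fun z : RT1Coord => ((1, z.2.2, 0) : RT1Coord))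
      ((0 : RT1Coord →L[ℝ] ℝ).prod
        (((ContinuousLinearMap.snd ℝ Plane Plane).comp prTangent).prod 0)) z := fun z =>
    (hasFDerivAt_const (1 : ℝ) z).prodMk
      (((ContinuousLinearMap.snd ℝ Plane Plane).comp prTangent).hasFDerivAt.prodMk
        (hasFDerivAt_const (0 : Plane) z))
  have hdEL : ∀ s ∈ J, ∀ w, DifferentiableAt ℝ (fun z => timeEL L z 0 w) (s, x, v) ∧ ∀ u,
      fderiv ℝ (fun z => timeEL L z 0 w) (s, x, v) (0, 0, u) =
        fderiv ℝ (fderiv ℝ L) (s, x, v) (0, 0, u) (0, w, 0)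
          - (fderiv ℝ (fderiv ℝ (fderiv ℝ L)) (s, x, v) (0, 0, u) (1, v, 0) (0, 0, w)
            + fderiv ℝ (fderiv ℝ L) (s, x, v) (0, u, 0) (0, 0, w)) := by
    intro s hs' w
    have h1 := hasFDerivAt_clm_apply_const (differentiableAt_of_contDiffAt
      (contDiffAt_fderiv (hL (s, x, v) hs' hx))) (0, w, 0)
    have h2 := (hdz s hs').hasFDerivAt.clm_apply (hs (s, x, v))
    have h3 := h2.clm_apply (hasFDerivAt_const ((0, 0, w) : RT1Coord) (s, x, v))
    have h4 := h1.sub h3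
    refine ⟨h4.differentiableAt, fun u => ?_⟩
    have h5 := congrArg (fun A : RT1Coord →L[ℝ] ℝ => A (0, 0, u)) h4.fderiv
    refine Eq.trans h5 ?_
    simp [prTangent, add_comm]
  -- Differentiate the expressions at `a = 0` by the velocity and antisymmetrize in `u` and `w`. The
  -- third derivatives of `L` are symmetric and cancel, and the mixed terms `∂²L/∂x∂v` add up twice,
  -- whence the factor `1 / 2`. The right side does not depend on `s`.
  have key : ∀ s ∈ J, fderiv ℝ (fderiv ℝ L) (s, x, v) (0, u, 0) (0, 0, w)
      - fderiv ℝ (fderiv ℝ L) (s, x, v) (0, w, 0) (0, 0, u) =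
      (1 / 2) * (fderiv ℝ (fun v => timeEL L (s, x, v) 0 u) v w
        - fderiv ℝ (fun v => timeEL L (s, x, v) 0 w) v u) := by
    intro s hs'
    have hz := hL (s, x, v) hs' hx
    rw [fderiv_slice (f := fun z => timeEL L z 0 u) (hdEL s hs' u).1,
      fderiv_slice (f := fun z => timeEL L z 0 w) (hdEL s hs' w).1, (hdEL s hs' u).2,
      (hdEL s hs' w).2, fderiv_fderiv_comm hz (0, 0, w), fderiv_fderiv_comm hz (0, 0, u),
      fderiv_fderiv_fderiv_comm_right hz (0, 0, w), fderiv_fderiv_fderiv_comm_left hz (0, 0, w),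
      fderiv_fderiv_fderiv_comm_right hz (0, 0, u) (1, v, 0),
      fderiv_fderiv_fderiv_comm_right hz (0, 0, u) (0, 0, w)]
    ring
  have hd := hdz t ht
  have hd1 := fun y => (hasFDerivAt_clm_apply_const hd y).differentiableAt
  have hd2 := fun y y' => (hasFDerivAt_clm_apply_const (hd1 y) y').differentiableAt
  have h0 := fderiv_eq_zero_of_eventually_const
    (f := fun z : RT1Coord => fderiv ℝ (fderiv ℝ L) z (0, u, 0) (0, 0, w)
      - fderiv ℝ (fderiv ℝ L) z (0, w, 0) (0, 0, u)) ((hd2 _ _).sub (hd2 _ _)) (by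
      filter_upwards [hJ.mem_nhds ht] with s hs'
      rw [key s hs', key t ht]
      simp only [hE s hs' t ht x hx])
  rw [fderiv_fun_sub (hd2 _ _) (hd2 _ _), sub_apply, fderiv_clm_apply_const (hd1 _),
    fderiv_clm_apply_const hd, fderiv_clm_apply_const (hd1 _), fderiv_clm_apply_const hd] at h0
  exact sub_eq_zero.1 h0

/-- The direction `(1, v, a)` of `d/dt` splits into `(0, v, a)`, which is tangent to the slice `t =
0`, and `∂/∂t`. -/
theorem timeEL_autonomous {t : ℝ} {z : TCoord} (hL : ContDiffAt ℝ ∞ L (t, z)) (ht : t = 0)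
    (a w : Plane) : timeEL L (t, z) a w =
      autonomousEL (fun y => L (ContinuousLinearMap.inr ℝ ℝ TCoord y)) z a w
        - fderiv ℝ (fderiv ℝ L) (t, z) (1, 0) (0, 0, w) := by
  subst ht
  rw [autonomousEL,
    fderiv_comp_clm (ContinuousLinearMap.inr ℝ ℝ TCoord) (differentiableAt_of_contDiffAt hL),
    fderiv_fderiv_comp_clm (ContinuousLinearMap.inr ℝ ℝ TCoord) hL]
  have : ((1, z.2, a) : RT1Coord) = (0, z.2, a) + (1, 0) := by simp
  simp only [timeEL]
  rw [this, map_add, add_apply]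
  simp only [ContinuousLinearMap.inr_apply]
  ring

/-- If the Euler-Lagrange expressions of `L` do not depend on time, they locally are those of a
function `l(x, v)`. -/
theorem exists_autonomousEL_eq (hJ : IsOpen J) (h0 : (0 : ℝ) ∈ J) (hT : IsOpen T)
    (hL : ∀ z : RT1Coord, z.1 ∈ J → z.2.1 ∈ T → ContDiffAt ℝ ∞ L z)
    (hE : ∀ t ∈ J, ∀ s ∈ J, ∀ x ∈ T, ∀ v a w, timeEL L (t, x, v) a w = timeEL L (s, x, v) a w)
    {x₀ : Plane} (hx₀ : x₀ ∈ T) :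
    ∃ U ⊆ T, IsOpen U ∧ x₀ ∈ U ∧ ∃ l : TCoord → ℝ, (∀ z, z.1 ∈ U → ContDiffAt ℝ ∞ l z) ∧
      ∀ z a w, z.1 ∈ U → autonomousEL l z a w = timeEL L (0, z) a w := by
  -- `T` need not be simply connected; on a ball closed 1-forms have potentials.
  obtain ⟨r, hr, hball⟩ := Metric.isOpen_iff.1 hT x₀ hx₀
  set U := Metric.ball x₀ r with hU
  have hUo : IsOpen U := Metric.isOpen_ball
  set j : Plane →L[ℝ] RT1Coord := (ContinuousLinearMap.inr ℝ ℝ TCoord).comp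
    (ContinuousLinearMap.inl ℝ Plane Plane) with hj
  set k : Plane →L[ℝ] RT1Coord := (ContinuousLinearMap.inr ℝ ℝ TCoord).comp
    (ContinuousLinearMap.inr ℝ Plane Plane) with hk
  -- The 1-form by which the time-dependent expressions differ from those of the frozen Lagrangian.
  -- By `time_vertical_eq` it may be evaluated at velocity `0`.
  set m : Plane → Plane →L[ℝ] ℝ := fun x => -(fderiv ℝ (fderiv ℝ L) (j x) (1, 0)).comp k with hm
  have hmsmooth : ∀ x ∈ U, ContDiffAt ℝ ∞ m x := by
    intro x hx
    have h1 : ContDiffAt ℝ ∞ (fun x => fderiv ℝ (fderiv ℝ L) (j x)) x :=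
      ContDiffAt.comp (g := fderiv ℝ (fderiv ℝ L)) x
        (contDiffAt_fderiv (contDiffAt_fderiv (hL (j x) h0 (hball hx)))) j.contDiff.contDiffAt
    exact ((h1.clm_apply contDiffAt_const).clm_comp contDiffAt_const).neg
  have hmderiv : ∀ x ∈ U, ∀ u w, fderiv ℝ m x u w =
      -fderiv ℝ (fderiv ℝ (fderiv ℝ L)) (0, x, 0) (1, 0) (0, u, 0) (0, 0, w) := by
    intro x hx u w
    have hz := hL (j x) h0 (hball hx)
    have hd := differentiableAt_of_contDiffAt (contDiffAt_fderiv (contDiffAt_fderiv hz))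
    have hd1 := (hasFDerivAt_clm_apply_const hd (1, 0)).differentiableAt
    have hd2 := (hasFDerivAt_clm_apply_const hd1 (k w)).differentiableAt
    have h1 : fderiv ℝ (fun x => m x w) x u =
        fderiv ℝ (fun x => -(fun z => fderiv ℝ (fderiv ℝ L) z (1, 0) (k w)) (j x)) x u := rfl
    rw [← fderiv_clm_apply_const (differentiableAt_of_contDiffAt (hmsmooth x hx)), h1,
      fderiv_fun_neg, neg_apply, fderiv_comp_clm j hd2, fderiv_clm_apply_const hd1,
      fderiv_clm_apply_const hd, fderiv_fderiv_fderiv_comm_left hz]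
    rfl
  obtain ⟨P, hP⟩ := (convex_ball x₀ r).exists_forall_hasFDerivAt_of_fderiv_symmetric hUo
    (fun x hx => (differentiableAt_of_contDiffAt (hmsmooth x hx)).differentiableWithinAt)
    (fun x hx u w => by
      rw [hmderiv x hx, hmderiv x hx,
        time_horizontal_vertical_comm hJ hL hE h0 (hball hx) 0 u w])
  -- The potential is only known to be differentiable; it is smooth because its derivative `m` is.
  have hPsmooth : ContDiffOn ℝ ∞ P U := by
    rw [contDiffOn_infty_iff_fderiv_of_isOpen hUo]
    refine ⟨fun x hx => (hP x hx).differentiableAt.differentiableWithinAt, ?_⟩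
    exact ContDiffOn.congr (fun x hx => (hmsmooth x hx).contDiffWithinAt)
      fun x hx => (hP x hx).fderiv
  have hPat : ∀ x ∈ U, ContDiffAt ℝ ∞ P x := fun x hx => hPsmooth.contDiffAt (hUo.mem_nhds hx)
  have hl : ∀ z : TCoord, z.1 ∈ U →
      ContDiffAt ℝ ∞ (fun z => L (ContinuousLinearMap.inr ℝ ℝ TCoord z)) z := fun z hz =>
    ContDiffAt.comp (g := L) z (hL (0, z) h0 (hball hz))
      (ContinuousLinearMap.inr ℝ ℝ TCoord).contDiff.contDiffAt
  have hPfst : ∀ z : TCoord, z.1 ∈ U → ContDiffAt ℝ ∞ (fun z : TCoord => P z.1) z := fun z hz =>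
    (hPat z.1 hz).comp z contDiffAt_fst
  refine ⟨U, hball, hUo, Metric.mem_ball_self hr,
    fun z => L (ContinuousLinearMap.inr ℝ ℝ TCoord z) + P z.1,
    fun z hz => (hl z hz).add (hPfst z hz), fun z a w hz => ?_⟩
  rw [autonomousEL_add (hl z hz) (hPfst z hz), autonomousEL_potential (hPat z.1 hz),
    timeEL_autonomous (hL (0, z) h0 (hball hz)) rfl, (hP z.1 hz).fderiv,
    time_vertical_eq hJ hL hE h0 (hball hz), sub_eq_add_neg]
  rfl

end Autonomization

/-! ## Existence in compatible charts -/

variable [ChartedSpace Plane M] {ε : FormFamily M RT2Coord 2}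

/-- The `εᵢ` transform as the components of a covector on `M`. The lift preserves time, so `dt`
vanishes on the image of `∂/∂xⁱ` and is `1` on the image of `∂/∂t`; of the wedge only the values of
the contact forms on the image of `∂/∂xⁱ` survive. -/
theorem coeff_transition (hsource : IsSourceForm ε) {φ φ' : OpenPartialHomeomorph M Plane}
    (hφ : φ ∈ IsManifold.maximalAtlas (𝓡 2) ∞ M) (hφ' : φ' ∈ IsManifold.maximalAtlas (𝓡 2) ∞ M)
    {z : RT2Coord} (hz : z.2.1 ∈ overlap φ φ') (i : Fin 2) :
    coeff ε φ i z =
      fderiv ℝ (φ' ∘ φ.symm) z.2.1 (e i) 0 * coeff ε φ' 0 (jet2.lift (φ' ∘ φ.symm) z)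
        + fderiv ℝ (φ' ∘ φ.symm) z.2.1 (e i) 1 * coeff ε φ' 1 (jet2.lift (φ' ∘ φ.symm) z) := by
  have hΦ := contDiffAt_transition hφ hφ' hz.1 hz.2
  set Φ := φ' ∘ φ.symm with hΦdef
  have hF : ∀ u : RT2Coord, (fderiv ℝ (jet2.lift Φ) z u).1 = u.1 ∧
      (fderiv ℝ (jet2.lift Φ) z u).2.1 = fderiv ℝ Φ z.2.1 u.2.1 := by
    intro u
    have h := prJet_fderiv_jet2_lift hΦ u
    rw [fderiv_jet1_lift (z := prJet z) hΦ,
      fderiv_tangent_lift (z := (prJet z).2) (hΦ.of_le two_le_infty)] at h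
    exact ⟨congrArg (fun y : RT1Coord => y.1) h, congrArg (fun y : RT1Coord => y.2.1) h⟩
  have h1 := congrArg (fun A => A ![((0, e i, 0, 0) : RT2Coord), (1, 0, 0, 0)])
    (hsource.1.2 φ hφ φ' hφ' z hz.1 hz.2)
  have h2 := hsource.2 φ' hφ' (jet2.lift Φ z) (transition_mem_target hz)
  simp only [← hΦdef] at h1
  rw [h2] at h1
  simp only [ContinuousAlternatingMap.compContinuousLinearMap_apply, wedge_apply] at h1
  have hd0 : ∀ u, dt2 (fderiv ℝ (jet2.lift Φ) z u) = u.1 := fun u => (hF u).1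
  have hc : ∀ k u, contactForm k (jet2.lift Φ z) (fderiv ℝ (jet2.lift Φ) z u) =
      fderiv ℝ Φ z.2.1 u.2.1 k - (jet2.lift Φ z).2.2.1 k * u.1 := by
    intro k u
    change (fderiv ℝ (jet2.lift Φ) z u).2.1 k
      - (jet2.lift Φ z).2.2.1 k * (fderiv ℝ (jet2.lift Φ) z u).1 = _
    rw [(hF u).1, (hF u).2]
  refine h1.trans ?_
  simp [hd0, hc]
  ring

theorem IsAutonomousLagrangian.comp_lift (hsource : IsSourceForm ε)
    {φ φ' : OpenPartialHomeomorph M Plane}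
    (hφ : φ ∈ IsManifold.maximalAtlas (𝓡 2) ∞ M) (hφ' : φ' ∈ IsManifold.maximalAtlas (𝓡 2) ∞ M)
    {U : Set Plane} {l : TCoord → ℝ} (hl : IsAutonomousLagrangian ε φ' U l) :
    IsAutonomousLagrangian ε φ (overlap φ φ' ∩ (φ' ∘ φ.symm) ⁻¹' U)
      (l ∘ tangent.lift (φ' ∘ φ.symm)) := by
  have hΦ := fun x (hx : x ∈ overlap φ φ') => contDiffAt_transition hφ hφ' hx.1 hx.2
  refine ⟨?_, fun x hx => hx.1.1, fun z hz => ?_, fun i t x v a hx => ?_⟩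
  · exact ContinuousOn.isOpen_inter_preimage
      (fun x hx => (hΦ x hx).continuousAt.continuousWithinAt) (isOpen_overlap φ φ') hl.isOpen
  · exact contDiffAt_comp_lift (hΦ _ hz.1) (hl.contDiffAt _ hz.2)
  · rw [coeff_transition hsource hφ hφ' (z := (t, x, v, a)) hx.1 i,
      autonomousEL_comp_lift (z := (x, v)) (hΦ _ hx.1) (hl.contDiffAt _ hx.2),
      autonomousEL_eq_sum]
    simp only [jet2]
    rw [hl.coeff_eq 0 _ _ _ _ hx.2, hl.coeff_eq 1 _ _ _ _ hx.2]
    rfl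

/-- Local variationality provides a Lagrangian in some chart `ψ` and for times near `0` only. Time
is removed in `ψ`, and the result is transported to the prescribed chart. -/
theorem exists_isAutonomousLagrangian (hsource : IsSourceForm ε) (htime : IsTimeIndependent ε)
    (hlocal : IsLocallyVariational ε) {φ : OpenPartialHomeomorph M Plane}
    (hφ : φ ∈ IsManifold.maximalAtlas (𝓡 2) ∞ M) {x : Plane} (hx : x ∈ φ.target) :
    ∃ U l, x ∈ U ∧ IsAutonomousLagrangian ε φ U l := by
  obtain ⟨ψ, hψ, hp, J, hJ, h0, L, hL, hE⟩ := hlocal 0 (φ.symm x)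
  have hD : IsOpen {z : RT1Coord | z.1 ∈ J ∧ z.2.1 ∈ ψ.target} :=
    (hJ.preimage continuous_fst).inter (ψ.open_target.preimage prBase.continuous)
  have hL' : ∀ z : RT1Coord, z.1 ∈ J → z.2.1 ∈ ψ.target → ContDiffAt ℝ ∞ L z :=
    fun z h1 h2 => hL.contDiffAt (hD.mem_nhds ⟨h1, h2⟩)
  have hcoeff : ∀ (i : Fin 2) (t : ℝ) (x v a : Plane), t ∈ J → x ∈ ψ.target →
      coeff ε ψ i (t, x, v, a) = timeEL L (t, x, v) a (e i) := by
    intro i t x v a ht hx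
    rw [hE i t x v a ht hx, eulerLagrange1_eq (hL' _ ht hx)]
    rfl
  have hconst : ∀ t ∈ J, ∀ s ∈ J, ∀ x ∈ ψ.target, ∀ v a w,
      timeEL L (t, x, v) a w = timeEL L (s, x, v) a w := by
    intro t ht s hs x hx v a w
    rw [timeEL_eq_sum, timeEL_eq_sum L (s, x, v)]
    simp only [← hcoeff _ _ _ _ _ ht hx, ← hcoeff _ _ _ _ _ hs hx,
      htime ψ hψ _ t s x v a hx]
  obtain ⟨U, hUT, hUo, hxU, l, hl, hlE⟩ := exists_autonomousEL_eq hJ h0 ψ.open_target hL' hconst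
    (ψ.map_source hp)
  have hψl : IsAutonomousLagrangian ε ψ U l := by
    refine ⟨hUo, hUT, hl, fun i t x v a hx => ?_⟩
    -- The time `t` is arbitrary and may lie outside `J`; time independence moves it to `0`.
    rw [htime ψ hψ i t 0 x v a (hUT hx), hcoeff i 0 x v a h0 (hUT hx), hlE (x, v) a (e i) hx]
  exact ⟨overlap φ ψ ∩ (ψ ∘ φ.symm) ⁻¹' U, _, ⟨⟨hx, hp⟩, hxU⟩, hψl.comp_lift hsource hφ hψ⟩

/-- Near a point in the domains of two charts there are local autonomous Lagrangians in both charts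
that correspond under the change of coordinates. -/
theorem exists_compatible_isAutonomousLagrangian (hsource : IsSourceForm ε)
    (htime : IsTimeIndependent ε) (hlocal : IsLocallyVariational ε)
    {φ φ' : OpenPartialHomeomorph M Plane}
    (hφ : φ ∈ IsManifold.maximalAtlas (𝓡 2) ∞ M) (hφ' : φ' ∈ IsManifold.maximalAtlas (𝓡 2) ∞ M)
    {x : Plane} (hx : x ∈ overlap φ φ') :
    ∃ U U' l, x ∈ U ∧ (φ' ∘ φ.symm) x ∈ U' ∧ IsAutonomousLagrangian ε φ' U' l ∧
      IsAutonomousLagrangian ε φ U (l ∘ tangent.lift (φ' ∘ φ.symm)) := by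
  obtain ⟨U', l, hU', hl⟩ := exists_isAutonomousLagrangian hsource htime hlocal hφ'
    (transition_mem_target hx)
  exact ⟨overlap φ φ' ∩ (φ' ∘ φ.symm) ⁻¹' U', U', l, ⟨hx, hU'⟩, hU', hl, hl.comp_lift hsource hφ hφ'⟩

end LocalLagrangian


/-! ## The forms `μ₀`, `κ`, `ω` in terms of a local autonomous Lagrangian -/

section LocalExpressions

theorem map_tcoord (f : TCoord →L[ℝ] ℝ) (u : TCoord) :
    f u = u.1 0 * f (e 0, 0) + u.1 1 * f (e 1, 0) + (u.2 0 * f (0, e 0) + u.2 1 * f (0, e 1)) := by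
  have h1 := map_plane ((f.comp (ContinuousLinearMap.inl ℝ Plane Plane) : Plane →L[ℝ] ℝ) :
    Plane →ₗ[ℝ] ℝ) u.1
  have h2 := map_plane ((f.comp (ContinuousLinearMap.inr ℝ Plane Plane) : Plane →L[ℝ] ℝ) :
    Plane →ₗ[ℝ] ℝ) u.2
  have h : f u = f (u.1, 0) + f (0, u.2) := by rw [← map_add]; simp
  rw [h]
  exact congrArg₂ (· + ·) h1 h2

theorem map_vertical (f : TCoord →L[ℝ] ℝ) (w : Plane) :
    f (0, w) = w 0 * f (0, e 0) + w 1 * f (0, e 1) := by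
  simpa using map_tcoord f (0, w)

theorem map_horizontal (f : TCoord →L[ℝ] ℝ) (w : Plane) :
    f (w, 0) = w 0 * f (e 0, 0) + w 1 * f (e 1, 0) := by
  simpa using map_tcoord f (w, 0)

theorem bilin_vertical (b : TCoord →L[ℝ] TCoord →L[ℝ] ℝ) (u y : TCoord) :
    b u y = u.1 0 * b (e 0, 0) y + u.1 1 * b (e 1, 0) y
      + (u.2 0 * b (0, e 0) y + u.2 1 * b (0, e 1) y) :=
  map_tcoord (b.flip y) u

theorem integral_fderiv_vertical {f : TCoord → ℝ} {x : Plane}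
    (hf : ∀ v, ContDiffAt ℝ ∞ f (x, v)) (q u : Plane) (s : ℝ) :
    IntervalIntegrable (fun ν : ℝ => fderiv ℝ f (x, q + ν • u) (0, u)) MeasureTheory.volume 0 s ∧
    ∫ ν in (0 : ℝ)..s, fderiv ℝ f (x, q + ν • u) (0, u) = f (x, q + s • u) - f (x, q) := by
  have hline : ∀ ν : ℝ, HasDerivAt (fun ν : ℝ => ((x, q + ν • u) : TCoord)) (0, u) ν := by
    intro ν
    have h1 : HasDerivAt (fun ν : ℝ => q + ν • u) u ν := by
      simpa using ((hasDerivAt_id ν).smul_const u).const_add q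
    exact (hasDerivAt_const ν x).prodMk h1
  have hcont : Continuous fun ν : ℝ => fderiv ℝ f (x, q + ν • u) (0, u) := by
    refine continuous_iff_continuousAt.2 fun ν => ?_
    have h1 : ContinuousAt (fun ν : ℝ => fderiv ℝ f (x, q + ν • u)) ν :=
      ContinuousAt.comp (g := fderiv ℝ f) (contDiffAt_fderiv (hf _)).continuousAt
        (hline ν).continuousAt
    exact h1.clm_apply continuousAt_const
  refine ⟨hcont.intervalIntegrable 0 s, ?_⟩
  rw [intervalIntegral.integral_eq_sub_of_hasDerivAt
    (f := fun ν : ℝ => f (x, q + ν • u)) ?_ (hcont.intervalIntegrable 0 s)]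
  · simp
  · intro ν _
    exact HasFDerivAt.comp_hasDerivAt (l := f) (f := fun ν : ℝ => ((x, q + ν • u) : TCoord)) ν
      (differentiableAt_of_contDiffAt (hf _)).hasFDerivAt (hline ν)

/-- The momentum `∂l/∂v` along the zero section. -/
def zeroMomentum (l : TCoord → ℝ) (x : Plane) : Plane →L[ℝ] ℝ := momentum l (x, 0)

theorem contDiffAt_zeroMomentum {l : TCoord → ℝ} {x : Plane} (hl : ContDiffAt ℝ ∞ l (x, 0)) :
    ContDiffAt ℝ ∞ (zeroMomentum l) x :=
  ContDiffAt.comp (g := momentum l) x (contDiffAt_momentum hl)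
    (ContinuousLinearMap.inl ℝ Plane Plane).contDiff.contDiffAt

theorem fderiv_zeroMomentum {l : TCoord → ℝ} {x : Plane} (hl : ContDiffAt ℝ ∞ l (x, 0))
    (u w : Plane) :
    fderiv ℝ (zeroMomentum l) x u w = fderiv ℝ (fderiv ℝ l) (x, 0) (u, 0) (0, w) := by
  rw [← fderiv_clm_apply_const (differentiableAt_of_contDiffAt (contDiffAt_zeroMomentum hl)),
    ← fderiv_fderiv_apply_const hl]
  exact fderiv_comp_clm (f := fun z => fderiv ℝ l z (0, w)) (ContinuousLinearMap.inl ℝ Plane Plane)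
    (hasFDerivAt_clm_apply_const
      (differentiableAt_of_contDiffAt (contDiffAt_fderiv hl)) _).differentiableAt u

variable {M : Type*} [TopologicalSpace M] {ε : FormFamily M RT2Coord 2}
  {φ : OpenPartialHomeomorph M Plane} {U : Set Plane} {l : TCoord → ℝ}

namespace IsAutonomousLagrangian

theorem eventually_mem (h : IsAutonomousLagrangian ε φ U l) {z : TCoord} (hz : z.1 ∈ U) :
    ∀ᶠ y in 𝓝 z, y.1 ∈ U :=
  (h.isOpen.preimage continuous_fst).mem_nhds hz

theorem coeffA_eq (h : IsAutonomousLagrangian ε φ U l) {z : TCoord} (hz : z.1 ∈ U) (i : Fin 2) :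
    coeffA ε φ i z = autonomousEL l z 0 (e i) :=
  h.coeff_eq i 0 z.1 z.2 0 hz

theorem coeffB_eq (h : IsAutonomousLagrangian ε φ U l) {z : TCoord} (hz : z.1 ∈ U)
    (i j : Fin 2) :
    coeffB ε φ i j z = -fderiv ℝ (fderiv ℝ l) z (0, e j) (0, e i) := by
  rw [coeffB, h.coeff_eq i 0 z.1 z.2 (e j) hz, h.coeff_eq i 0 z.1 z.2 0 hz, autonomousEL_affine]
  ring

theorem coeff_affine (h : IsAutonomousLagrangian ε φ U l) {x : Plane} (hx : x ∈ U) (i : Fin 2)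
    (t : ℝ) (v a : Plane) : coeff ε φ i (t, x, v, a) =
      coeffA ε φ i (x, v) + coeffB ε φ i 0 (x, v) * a 0 + coeffB ε φ i 1 (x, v) * a 1 := by
  rw [h.coeff_eq i t x v a hx, h.coeffA_eq (z := (x, v)) hx, h.coeffB_eq (z := (x, v)) hx,
    h.coeffB_eq (z := (x, v)) hx, autonomousEL_affine,
    bilin_vertical (fderiv ℝ (fderiv ℝ l) (x, v)) (0, a)]
  simp
  ring

theorem fderiv_coeffA (h : IsAutonomousLagrangian ε φ U l) {z : TCoord} (hz : z.1 ∈ U)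
    (i : Fin 2) (u : Plane) :
    fderiv ℝ (coeffA ε φ i) z (0, u) = fderiv ℝ (fderiv ℝ l) z (0, u) (e i, 0)
      - (fderiv ℝ (fderiv ℝ (fderiv ℝ l)) z (0, u) (z.2, 0) (0, e i)
        + fderiv ℝ (fderiv ℝ l) z (u, 0) (0, e i)) := by
  have hl := h.contDiffAt z hz
  have hev : coeffA ε φ i =ᶠ[𝓝 z]
      fun y => fderiv ℝ l y (e i, 0) - fderiv ℝ (fderiv ℝ l) y (y.2, 0) (0, e i) := by
    filter_upwards [h.eventually_mem hz] with y hy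
    exact h.coeffA_eq hy i
  have hd1 := differentiableAt_of_contDiffAt (contDiffAt_fderiv hl)
  have hd2 := differentiableAt_of_contDiffAt (contDiffAt_fderiv (contDiffAt_fderiv hl))
  have hs : HasFDerivAt (fun y : TCoord => ((y.2, 0) : TCoord))
      ((ContinuousLinearMap.snd ℝ Plane Plane).prod 0) z :=
    (ContinuousLinearMap.snd ℝ Plane Plane).hasFDerivAt.prodMk (hasFDerivAt_const (0 : Plane) z)
  have h1 := (hasFDerivAt_clm_apply_const hd1 (e i, 0)).sub
    ((hd2.hasFDerivAt.clm_apply hs).clm_apply (hasFDerivAt_const ((0, e i) : TCoord) z))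
  rw [hev.fderiv_eq]
  refine (congrArg (fun A : TCoord →L[ℝ] ℝ => A (0, u)) h1.fderiv).trans ?_
  simp [add_comm]

/-- In the antisymmetrized velocity derivatives of `Aᵢ` the third derivatives of `l` cancel and the
mixed second derivatives occur twice. -/
theorem coeffC_eq (h : IsAutonomousLagrangian ε φ U l) {z : TCoord} (hz : z.1 ∈ U) :
    coeffC ε φ z = fderiv ℝ (fderiv ℝ l) z (e 0, 0) (0, e 1)
      - fderiv ℝ (fderiv ℝ l) z (e 1, 0) (0, e 0) := by
  have hl := h.contDiffAt z hz
  rw [coeffC, h.fderiv_coeffA hz, h.fderiv_coeffA hz, fderiv_fderiv_comm hl (0, e 1),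
    fderiv_fderiv_comm hl (0, e 0), fderiv_fderiv_fderiv_comm_right hl (0, e 1),
    fderiv_fderiv_fderiv_comm_left hl (0, e 1), fderiv_fderiv_fderiv_comm_right hl (0, e 0)]
  ring

/-- The coefficient `-Aᵢ` contains `∑ vʲ ∂²l/∂xʲ∂vⁱ`, while `∂E/∂xⁱ` contains `∑ vʲ ∂²l/∂xⁱ∂vʲ`. The
terms with `C` exchange one for the other; the coefficients of `dẋⁱ` are `t ∂E/∂vⁱ`. -/
theorem muZero_eq (h : IsAutonomousLagrangian ε φ U l) {z : RT1Coord} (hz : z.2.1 ∈ U) :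
    muZero ε φ z = oneForm (z.1 • (fderiv ℝ (energy l) z.2).comp prTangent) := by
  obtain ⟨t, x, v⟩ := z
  have hl := h.contDiffAt (x, v) hz
  ext w
  have hb := fun i => bilin_vertical (fderiv ℝ (fderiv ℝ l) (x, v)) (v, 0) (0, e i)
  have hw := bilin_vertical (fderiv ℝ (fderiv ℝ l) (x, v)) (w 0).2 (0, v)
  have hs := fderiv_fderiv_comm hl (0, e 0) (0, e 1)
  have hv := fun y => map_vertical (fderiv ℝ (fderiv ℝ l) (x, v) y) v
  rw [hv (e 0, 0), hv (e 1, 0), hv (0, e 0), hv (0, e 1)] at hw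
  have hA : ∀ i, coeffA ε φ i (x, v) = fderiv ℝ l (x, v) (e i, 0)
      - fderiv ℝ (fderiv ℝ l) (x, v) (v, 0) (0, e i) := h.coeffA_eq (z := (x, v)) hz
  have hE : (fderiv ℝ (energy l) (x, v)) (w 0).2 =
      fderiv ℝ (fderiv ℝ l) (x, v) (w 0).2 (0, v) - fderiv ℝ l (x, v) ((w 0).2.1, 0) :=
    fderiv_energy hl _
  have hc := h.coeffC_eq (z := (x, v)) hz
  change - ((coeffA ε φ 0 (x, v) - coeffC ε φ (x, v) * v 1) * t) * (w 0).2.1 0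
    - ((coeffA ε φ 1 (x, v) + coeffC ε φ (x, v) * v 0) * t) * (w 0).2.1 1
    - ((coeffB ε φ 0 0 (x, v) * v 0 + coeffB ε φ 0 1 (x, v) * v 1) * t) * (w 0).2.2 0
    - ((coeffB ε φ 0 1 (x, v) * v 0 + coeffB ε φ 1 1 (x, v) * v 1) * t) * (w 0).2.2 1
    = t * fderiv ℝ (energy l) (x, v) (w 0).2
  simp only [h.coeffB_eq (z := (x, v)) hz, hA, hc, hb, hE, hw,
    map_horizontal (fderiv ℝ l (x, v)) (w 0).2.1, PiLp.zero_apply, hs]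
  ring

/-- Since `-Bᵢⱼ = ∂pᵢ/∂vʲ`, the integrals are increments of the momentum along the broken path from
`0` to `(0, ẏ)` and on to `(ẋ, ẏ)`. -/
theorem kappa_eq (h : IsAutonomousLagrangian ε φ U l) {z : TCoord} (hz : z.1 ∈ U) :
    kappa ε φ z = oneForm ((momentum l z - zeroMomentum l z.1).comp
      (ContinuousLinearMap.fst ℝ Plane Plane)) := by
  obtain ⟨x, v⟩ := z
  have hl := fun v => h.contDiffAt (x, v) hz
  have hlu : ∀ w v, ContDiffAt ℝ ∞ (fun y => fderiv ℝ l y w) (x, v) := fun w v =>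
    contDiffAt_fderiv_apply (hl v) contDiffAt_const
  have hq : ∀ ν c : ℝ, !₂[ν, c] = c • e 1 + ν • e 0 := fun ν c => by
    ext i; fin_cases i <;> simp [e]
  have hq' : ∀ σ : ℝ, !₂[0, σ] = (0 : Plane) + σ • e 1 := fun ν => by
    ext i; fin_cases i <;> simp [e]
  have hB : ∀ i j v, coeffB ε φ i j (x, v) =
      -fderiv ℝ (fun y => fderiv ℝ l y (0, e i)) (x, v) (0, e j) := fun i j v => by
    rw [h.coeffB_eq (z := (x, v)) hz, fderiv_fderiv_apply_const (hl v)]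
  -- On the horizontal leg the coefficient `B₀₁` must serve as `B₁₀`, the derivative of `-p₁` along
  -- `ẋ`; the Hessian of `l` is symmetric.
  have hB' : ∀ v, coeffB ε φ 0 1 (x, v) =
      -fderiv ℝ (fun y => fderiv ℝ l y (0, e 1)) (x, v) (0, e 0) := fun v => by
    rw [h.coeffB_eq (z := (x, v)) hz, fderiv_fderiv_apply_const (hl v),
      fderiv_fderiv_comm (hl v)]
  have i1 : ∀ i, ∫ ν in (0 : ℝ)..(v 0), -fderiv ℝ (fun y => fderiv ℝ l y (0, e i))
      (x, v 1 • e 1 + ν • e 0) (0, e 0) =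
        -(fderiv ℝ l (x, v) (0, e i) - fderiv ℝ l (x, v 1 • e 1) (0, e i)) := fun i => by
    rw [intervalIntegral.integral_neg, (integral_fderiv_vertical (hlu (0, e i)) _ _ _).2,
      add_comm, ← plane_eq v]
  have i2 : ∀ i, ∫ σ in (0 : ℝ)..(v 1), -fderiv ℝ (fun y => fderiv ℝ l y (0, e i))
      (x, 0 + σ • e 1) (0, e 1) =
        -(fderiv ℝ l (x, v 1 • e 1) (0, e i) - fderiv ℝ l (x, 0) (0, e i)) := fun i => by
    rw [intervalIntegral.integral_neg, (integral_fderiv_vertical (hlu (0, e i)) _ _ _).2, zero_add]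
  ext w
  change - ((∫ ν in (0 : ℝ)..(v 0), coeffB ε φ 0 0 (x, !₂[ν, v 1]))
      + ∫ σ in (0 : ℝ)..(v 1), coeffB ε φ 0 1 (x, !₂[0, σ])) * (w 0).1 0
    - ((∫ ν in (0 : ℝ)..(v 0), coeffB ε φ 0 1 (x, !₂[ν, v 1]))
      + ∫ σ in (0 : ℝ)..(v 1), coeffB ε φ 1 1 (x, !₂[0, σ])) * (w 0).1 1
    = fderiv ℝ l (x, v) (0, (w 0).1) - fderiv ℝ l (x, 0) (0, (w 0).1)
  have j00 : ∫ ν in (0 : ℝ)..(v 0), coeffB ε φ 0 0 (x, !₂[ν, v 1]) =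
      -(fderiv ℝ l (x, v) (0, e 0) - fderiv ℝ l (x, v 1 • e 1) (0, e 0)) := by
    simp only [hq, hB]; exact i1 0
  have j01 : ∫ σ in (0 : ℝ)..(v 1), coeffB ε φ 0 1 (x, !₂[0, σ]) =
      -(fderiv ℝ l (x, v 1 • e 1) (0, e 0) - fderiv ℝ l (x, 0) (0, e 0)) := by
    simp only [hq', hB]; exact i2 0
  have j10 : ∫ ν in (0 : ℝ)..(v 0), coeffB ε φ 0 1 (x, !₂[ν, v 1]) =
      -(fderiv ℝ l (x, v) (0, e 1) - fderiv ℝ l (x, v 1 • e 1) (0, e 1)) := by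
    simp only [hq, hB']; exact i1 1
  have j11 : ∫ σ in (0 : ℝ)..(v 1), coeffB ε φ 1 1 (x, !₂[0, σ]) =
      -(fderiv ℝ l (x, v 1 • e 1) (0, e 1) - fderiv ℝ l (x, 0) (0, e 1)) := by
    simp only [hq', hB]; exact i2 1
  rw [j00, j01, j10, j11, map_vertical (fderiv ℝ l (x, v)) (w 0).1,
    map_vertical (fderiv ℝ l (x, 0)) (w 0).1]
  ring

/-- At `v = 0` the function `C` is the curl of the momentum along the zero section. -/
theorem omega_eq (h : IsAutonomousLagrangian ε φ U l) {x : Plane} (hx : x ∈ U) :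
    omega ε φ x = extDeriv (fun y => oneForm (zeroMomentum l y)) x := by
  have hl := h.contDiffAt (x, 0) hx
  have hd := differentiableAt_of_contDiffAt (contDiffAt_oneForm (contDiffAt_zeroMomentum hl))
  ext w
  rw [extDeriv_one_apply hd]
  change coeffC ε φ (x, 0) * wedge (dxBase 0) (dxBase 1) w =
    fderiv ℝ (zeroMomentum l) x (w 0) (w 1) - fderiv ℝ (zeroMomentum l) x (w 1) (w 0)
  rw [fderiv_zeroMomentum hl, fderiv_zeroMomentum hl, wedge_apply, h.coeffC_eq (z := (x, 0)) hx,
    map_vertical _ (w 1), map_vertical _ (w 0)]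
  simp only [bilin_vertical (fderiv ℝ (fderiv ℝ l) (x, 0)) (w 1, 0),
    bilin_vertical (fderiv ℝ (fderiv ℝ l) (x, 0)) (w 0, 0), PiLp.zero_apply]
  have hp : ∀ (i : Fin 2) (y : Plane), dxBase i y = y i := fun _ _ => rfl
  simp only [hp]
  ring

end IsAutonomousLagrangian

end LocalExpressions


section Global

variable {M : Type*} [TopologicalSpace M]

/-! ## A first-order Lagrangian on `ℝ × T¹M` -/

/-- The Lagrange function `∫₀¹ κ(x, s v)(v) ds + η(v) - t ∑ Aᵢ(x, 0) vⁱ`. -/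
def firstOrderFunction (ε : FormFamily M RT2Coord 2) (η : FormFamily M Plane 1)
    (φ : OpenPartialHomeomorph M Plane) (z : RT1Coord) : ℝ :=
  (∫ s in (0 : ℝ)..1, covector (kappa ε φ (z.2.1, s • z.2.2)) (z.2.2, 0))
    + covector (η φ z.2.1) z.2.2
    - z.1 * (coeffA ε φ 0 (z.2.1, 0) * z.2.2 0 + coeffA ε φ 1 (z.2.1, 0) * z.2.2 1)

/-- The first-order Lagrangian with the Lagrange function `firstOrderFunction`. -/
def firstOrderLagrangian (ε : FormFamily M RT2Coord 2) (η : FormFamily M Plane 1) :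
    FormFamily M RT1Coord 1 :=
  fun φ z => firstOrderFunction ε η φ z • oneForm dt1

/-- The expression of `firstOrderFunction` in terms of a local Lagrangian. -/
def reducedFunction (l : TCoord → ℝ) (β : Plane → Plane →L[ℝ] ℝ) (z : RT1Coord) : ℝ :=
  l z.2 - l (z.2.1, 0) - zeroMomentum l z.2.1 z.2.2 + β z.2.1 z.2.2
    - z.1 * fderiv ℝ l (z.2.1, 0) (z.2.2, 0)

variable {ε : FormFamily M RT2Coord 2} {η : FormFamily M Plane 1}
  {φ : OpenPartialHomeomorph M Plane} {U : Set Plane} {l : TCoord → ℝ}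

/-- Along the ray `s v`, `κ(v)` is the derivative of `l` in `s` minus the constant `θ(v)`. At zero
velocity and acceleration the `d/dt` term vanishes, so `Aᵢ(x, 0) = ∂l/∂xⁱ(x, 0)`. -/
theorem IsAutonomousLagrangian.firstOrderFunction_eq (h : IsAutonomousLagrangian ε φ U l)
    {z : RT1Coord} (hz : z.2.1 ∈ U) :
    firstOrderFunction ε η φ z = reducedFunction l (fun x => covector (η φ x)) z := by
  obtain ⟨t, x, v⟩ := z
  have hl := fun v => h.contDiffAt (x, v) hz
  have hk : ∀ s : ℝ, covector (kappa ε φ (x, s • v)) (v, 0) =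
      fderiv ℝ l (x, 0 + s • v) (0, v) - zeroMomentum l x v := fun s => by
    rw [h.kappa_eq (z := (x, s • v)) hz, covector_apply, zero_add]
    rfl
  have hA : ∀ i, coeffA ε φ i (x, 0) = fderiv ℝ l (x, 0) (e i, 0) := fun i => by
    rw [h.coeffA_eq (z := (x, 0)) hz, autonomousEL]
    change _ - fderiv ℝ (fderiv ℝ l) (x, 0) (0 : TCoord) (0, e i) = _
    simp
  obtain ⟨hint, hftc⟩ := integral_fderiv_vertical hl 0 v 1
  have hI : ∫ s in (0 : ℝ)..1, covector (kappa ε φ (x, s • v)) (v, 0) =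
      l (x, v) - l (x, 0) - zeroMomentum l x v := by
    simp only [hk]
    rw [intervalIntegral.integral_sub hint (by simp), hftc]
    simp
  simp only [firstOrderFunction, reducedFunction]
  rw [hI, hA, hA, map_horizontal (fderiv ℝ l (x, 0)) v]
  ring

theorem contDiffAt_reducedFunction {β : Plane → Plane →L[ℝ] ℝ} {z : RT1Coord}
    (hl : ContDiffAt ℝ ∞ l z.2) (hl0 : ContDiffAt ℝ ∞ l (z.2.1, 0))
    (hβ : ContDiffAt ℝ ∞ β z.2.1) : ContDiffAt ℝ ∞ (reducedFunction l β) z := by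
  have hx : ContDiffAt ℝ ∞ (fun z : RT1Coord => z.2.1) z := prBase.contDiff.contDiffAt
  have hx0 : ContDiffAt ℝ ∞ (fun z : RT1Coord => ((z.2.1, 0) : TCoord)) z :=
    hx.prodMk contDiffAt_const
  have hv : ContDiffAt ℝ ∞ (fun z : RT1Coord => z.2.2) z := contDiffAt_snd.comp z contDiffAt_snd
  have h1 : ContDiffAt ℝ ∞ (fun z : RT1Coord => l z.2) z := hl.comp z contDiffAt_snd
  have h2 : ContDiffAt ℝ ∞ (fun z : RT1Coord => l (z.2.1, 0)) z :=
    ContDiffAt.comp (g := l) z hl0 hx0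
  have h3 : ContDiffAt ℝ ∞ (fun z : RT1Coord => zeroMomentum l z.2.1 z.2.2) z :=
    (ContDiffAt.comp (g := zeroMomentum l) z (contDiffAt_zeroMomentum hl0) hx).clm_apply hv
  have h4 : ContDiffAt ℝ ∞ (fun z : RT1Coord => β z.2.1 z.2.2) z :=
    (ContDiffAt.comp (g := β) z hβ hx).clm_apply hv
  have h5 : ContDiffAt ℝ ∞ (fun z : RT1Coord => fderiv ℝ l (z.2.1, 0) (z.2.2, 0)) z :=
    (ContDiffAt.comp (g := fderiv ℝ l) z (contDiffAt_fderiv hl0) hx0).clm_apply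
      (hv.prodMk contDiffAt_const)
  exact (((h1.sub h2).sub h3).add h4).sub (contDiffAt_fst.mul h5)

theorem zeroMomentum_comp_lift {Φ : Plane → Plane} {x : Plane} (hΦ : ContDiffAt ℝ 2 Φ x)
    (hl : DifferentiableAt ℝ l (Φ x, 0)) :
    zeroMomentum (l ∘ tangent.lift Φ) x = (zeroMomentum l (Φ x)).comp (fderiv ℝ Φ x) := by
  have h0 : tangent.lift Φ (x, 0) = (Φ x, 0) := by simp [tangent]
  rw [zeroMomentum, momentum_comp_lift (z := (x, 0)) hΦ (h0 ▸ hl), h0]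
  rfl

/-- Each summand is natural because lifts preserve the zero section and are linear on fibres. -/
theorem reducedFunction_comp_lift {Φ : Plane → Plane} {β : Plane → Plane →L[ℝ] ℝ} {z : RT1Coord}
    (hΦ : ContDiffAt ℝ 2 Φ z.2.1) (hl : DifferentiableAt ℝ l (Φ z.2.1, 0)) :
    reducedFunction (l ∘ tangent.lift Φ) (fun x => (β (Φ x)).comp (fderiv ℝ Φ x)) z =
      reducedFunction l β (jet1.lift Φ z) := by
  have h0 : tangent.lift Φ (z.2.1, 0) = (Φ z.2.1, 0) := by simp [tangent]
  simp only [reducedFunction]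
  rw [zeroMomentum_comp_lift hΦ hl, fderiv_comp_lift (z := (z.2.1, 0)) hΦ (h0 ▸ hl), h0]
  simp [tangent, jet1]

/-- A local Lagrangian corrected by a 1-form on `M` with the exterior derivative `ω`. -/
theorem IsAutonomousLagrangian.autonomousEL_gauge (h : IsAutonomousLagrangian ε φ U l)
    {x : Plane} (hx : x ∈ U) (hη : ContDiffAt ℝ ∞ (η φ) x)
    (hdη : extDeriv (η φ) x = omega ε φ x) (i : Fin 2) (t : ℝ) (v a : Plane) :
    ContDiffAt ℝ ∞
      (fun z : TCoord => l z + (covector (η φ z.1) z.2 - zeroMomentum l z.1 z.2)) (x, v) ∧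
    autonomousEL (fun z => l z + (covector (η φ z.1) z.2 - zeroMomentum l z.1 z.2)) (x, v) a (e i) =
      coeff ε φ i (t, x, v, a) := by
  have hθ := contDiffAt_zeroMomentum (h.contDiffAt (x, 0) hx)
  have hβ : ContDiffAt ℝ ∞ (fun y => covector (η φ y)) x :=
    (covector (X := Plane)).contDiff.contDiffAt.comp x hη
  have hγ : ContDiffAt ℝ ∞ (fun y => covector (η φ y) - zeroMomentum l y) x := hβ.sub hθ
  -- Both `η` and the momentum along the zero section are primitives of `ω` at `x`, so their
  -- difference is closed there and its gyroscopic contribution vanishes.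
  have hsymm : ∀ u w, fderiv ℝ (fun y => covector (η φ y) - zeroMomentum l y) x u w =
      fderiv ℝ (fun y => covector (η φ y) - zeroMomentum l y) x w u := by
    intro u w
    have h1 := congrArg (fun A => A ![u, w]) (hdη.trans (h.omega_eq hx))
    simp only [extDeriv_one_apply (differentiableAt_of_contDiffAt hη),
      extDeriv_one_apply (differentiableAt_of_contDiffAt (contDiffAt_oneForm hθ))] at h1
    have h2 : fderiv ℝ (fun y => covector (η φ y)) x u w -
        fderiv ℝ (fun y => covector (η φ y)) x w u =
        fderiv ℝ (zeroMomentum l) x u w - fderiv ℝ (zeroMomentum l) x w u := h1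
    rw [fderiv_fun_sub (differentiableAt_of_contDiffAt hβ) (differentiableAt_of_contDiffAt hθ)]
    simp only [sub_apply]
    linarith
  have hg := contDiffAt_gyroscopic (z := (x, v)) hγ
  have hE := autonomousEL_add (h.contDiffAt (x, v) hx) hg a (e i)
  rw [autonomousEL_gyroscopic (z := (x, v)) hγ, hsymm, sub_self, add_zero,
    ← h.coeff_eq i t x v a hx] at hE
  exact ⟨(h.contDiffAt (x, v) hx).add hg, hE⟩

theorem IsAutonomousLagrangian.eulerLagrange1_firstOrderFunction
    (h : IsAutonomousLagrangian ε φ U l) {x : Plane} (hx : x ∈ U)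
    (hη : ContDiffAt ℝ ∞ (η φ) x) (hdη : extDeriv (η φ) x = omega ε φ x) (i : Fin 2) (t : ℝ)
    (v a : Plane) :
    eulerLagrange1 (firstOrderFunction ε η φ) i (t, x, v, a) = coeff ε φ i (t, x, v, a) := by
  obtain ⟨hsmooth, hgauge⟩ := h.autonomousEL_gauge hx hη hdη i t v a
  set k : TCoord → ℝ := fun z => l z + (covector (η φ z.1) z.2 - zeroMomentum l z.1 z.2) with hk
  -- The total derivative of `g` collects `-l(x, 0)` and the term linear in `t`; the rest of the
  -- Lagrange function is `k`.
  set g : ℝ × Plane → ℝ := fun y => -(y.1 * l (y.2, 0)) with hg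
  have hl0 := h.contDiffAt (x, 0) hx
  have hlin : ∀ y : ℝ × Plane, HasFDerivAt (fun y : ℝ × Plane => ((y.2, 0) : TCoord))
      ((ContinuousLinearMap.snd ℝ ℝ Plane).prod 0) y := fun y =>
    (ContinuousLinearMap.snd ℝ ℝ Plane).hasFDerivAt.prodMk (hasFDerivAt_const (0 : Plane) y)
  have hgsmooth : ContDiffAt ℝ ∞ g (t, x) :=
    (contDiffAt_fst.mul (ContDiffAt.comp (g := l) (t, x) hl0
      (contDiffAt_snd.prodMk contDiffAt_const))).neg
  have hgderiv : ∀ y : ℝ × Plane, y.2 ∈ U → ∀ v, fderiv ℝ g y (1, v) =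
      -(l (y.2, 0)) - y.1 * fderiv ℝ l (y.2, 0) (v, 0) := by
    intro y hy v
    have h1 := HasFDerivAt.comp (g := l) y
      (differentiableAt_of_contDiffAt (h.contDiffAt (y.2, 0) hy)).hasFDerivAt (hlin y)
    have h2 := (hasFDerivAt_fst (𝕜 := ℝ) (E := ℝ) (F := Plane) (p := y)).mul h1
    refine (congrArg (fun A : ℝ × Plane →L[ℝ] ℝ => A (1, v)) h2.neg.fderiv).trans ?_
    simp
    ring
  have hev : firstOrderFunction ε η φ =ᶠ[𝓝 (t, x, v)]
      fun z => k (prTangent z) + fderiv ℝ g (z.1, z.2.1) (1, z.2.2) := by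
    filter_upwards [(h.isOpen.preimage prBase.continuous).mem_nhds hx] with z hz
    rw [h.firstOrderFunction_eq hz, hgderiv (z.1, z.2.1) hz]
    simp only [reducedFunction, hk, prTangent]
    change _ = l z.2 + (covector (η φ z.2.1) z.2.2 - zeroMomentum l z.2.1 z.2.2) + _
    ring
  have hk1 : ContDiffAt ℝ ∞ (fun z : RT1Coord => k (prTangent z)) (t, x, v) :=
    ContDiffAt.comp (g := k) (t, x, v) hsmooth prTangent.contDiff.contDiffAt
  have hg1 : ContDiffAt ℝ ∞ (fun z : RT1Coord => fderiv ℝ g (z.1, z.2.1) (1, z.2.2)) (t, x, v) :=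
    (ContDiffAt.comp (g := fderiv ℝ g) (f := fun z : RT1Coord => (z.1, z.2.1)) (t, x, v)
      (contDiffAt_fderiv hgsmooth)
      (contDiffAt_fst.prodMk prBase.contDiff.contDiffAt)).clm_apply
      (contDiffAt_const.prodMk (contDiffAt_snd.comp (t, x, v) contDiffAt_snd))
  rw [eulerLagrange1_congr hev, eulerLagrange1_add hk1 hg1,
    eulerLagrange1_comp_prTangent hsmooth, eulerLagrange1_fderiv_apply hgsmooth, add_zero, hgauge]

theorem IsAutonomousLagrangian.eulerLagrange2_globalLagrangian
    (h : IsAutonomousLagrangian ε φ U l) {x : Plane} (hx : x ∈ U)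
    (hη : ContDiffAt ℝ ∞ (η φ) x) (hdη : extDeriv (η φ) x = omega ε φ x) (i : Fin 2) (t : ℝ)
    (v a b c : Plane) :
    eulerLagrange2 (lagrangeFunction2 (globalLagrangian ε η) φ) i (t, x, v, a, b, c) =
      coeff ε φ i (t, x, v, a) := by
  obtain ⟨hsmooth, hgauge⟩ := h.autonomousEL_gauge hx hη hdη i t v a
  set k : TCoord → ℝ := fun z => l z + (covector (η φ z.1) z.2 - zeroMomentum l z.1 z.2) with hk
  set G : RT1Coord → ℝ := fun z => z.1 * energy l z.2 with hG
  have hl := h.contDiffAt (x, v) hx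
  have hGsmooth : ContDiffAt ℝ ∞ G (t, x, v) :=
    contDiffAt_fst.mul (ContDiffAt.comp (g := energy l) (t, x, v) (contDiffAt_energy hl)
      contDiffAt_snd)
  have hk1 : ContDiffAt ℝ ∞ (fun z : RT1Coord => k (prTangent z)) (t, x, v) :=
    ContDiffAt.comp (g := k) (t, x, v) hsmooth prTangent.contDiff.contDiffAt
  have hGderiv : ∀ z : RT1Coord, z.2.1 ∈ U → ∀ u, fderiv ℝ G z u =
      z.1 * fderiv ℝ (energy l) z.2 u.2 + u.1 * energy l z.2 := by
    intro z hz u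
    have h1 := HasFDerivAt.comp (g := energy l) z (differentiableAt_of_contDiffAt
      (contDiffAt_energy (h.contDiffAt z.2 hz))).hasFDerivAt hasFDerivAt_snd
    have h2 := (hasFDerivAt_fst (𝕜 := ℝ) (E := ℝ) (F := TCoord) (p := z)).mul h1
    refine (congrArg (fun A : RT1Coord →L[ℝ] ℝ => A u) h2.fderiv).trans ?_
    simp
    ring
  have hpos : Continuous fun z : RT2Coord => z.2.1 := continuous_fst.comp continuous_snd
  -- Here `t dE/dt = d(tE)/dt - E`, and `-E + p(v) = l`; the remaining terms `η(v) - θ(v)` complete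
  -- `k`.
  have hev : lagrangeFunction2 (globalLagrangian ε η) φ =ᶠ[𝓝 (t, x, v, a)]
      fun z => totalDeriv1 G z + k (prTangent (prJet z)) := by
    filter_upwards [(h.isOpen.preimage hpos).mem_nhds hx] with z hz
    have hzU : z.2.1 ∈ U := hz
    have e1 : lagrangeFunction2 (globalLagrangian ε η) φ z =
        (muZero ε φ (prJet z) (fun _ => (1, z.2.2))
          + kappa ε φ (z.2.1, z.2.2.1) (fun _ => z.2.2)
          + η φ z.2.1 (fun _ => z.2.2.1)) * 1 := rfl
    rw [e1, h.muZero_eq (z := prJet z) hzU, h.kappa_eq (z := (z.2.1, z.2.2.1)) hzU,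
      totalDeriv1_apply, hGderiv (prJet z) hzU]
    change (z.1 * fderiv ℝ (energy l) (z.2.1, z.2.2.1) z.2.2
      + (fderiv ℝ l (z.2.1, z.2.2.1) (0, z.2.2.1) - zeroMomentum l z.2.1 z.2.2.1)
      + covector (η φ z.2.1) z.2.2.1) * 1 =
      z.1 * fderiv ℝ (energy l) (z.2.1, z.2.2.1) z.2.2
      + 1 * (fderiv ℝ l (z.2.1, z.2.2.1) (0, z.2.2.1) - l (z.2.1, z.2.2.1))
      + (l (z.2.1, z.2.2.1) + (covector (η φ z.2.1) z.2.2.1 - zeroMomentum l z.2.1 z.2.2.1))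
    ring
  rw [eulerLagrange2_congr hev,
    eulerLagrange2_totalDeriv1_add (K := fun z => k (prTangent z)) hGsmooth hk1,
    eulerLagrange1_comp_prTangent hsmooth, hgauge]

/-! ## Global assertions -/

variable [ChartedSpace Plane M]

theorem IsForm.contDiffAt_base {k : ℕ} {ρ : FormFamily M Plane k} (hρ : IsForm base ρ)
    (hφ : φ ∈ IsManifold.maximalAtlas (𝓡 2) ∞ M) {x : Plane} (hx : x ∈ φ.target) :
    ContDiffAt ℝ ∞ (ρ φ) x :=
  (hρ.1 φ hφ).contDiffAt (φ.open_target.mem_nhds hx)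

/-- Three vectors in a plane are linearly dependent. -/
theorem d_eqForm_zero (ρ : FormFamily M Plane 2) : EqForm base (d ρ) (fun _ _ => 0) := by
  intro φ _ x _
  ext w
  refine AlternatingMap.map_linearDependent (K := ℝ) (d ρ φ x).toAlternatingMap w fun hw => ?_
  have := hw.fintype_card_le_finrank
  simp at this

theorem isForm_muZero (hsource : IsSourceForm ε) (htime : IsTimeIndependent ε)
    (hlocal : IsLocallyVariational ε) : IsForm jet1 (muZero ε) := by
  refine ⟨fun φ hφ z hz => ContDiffAt.contDiffWithinAt ?_, fun φ hφ φ' hφ' z hz hz' => ?_⟩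
  · obtain ⟨U, l, hxU, h⟩ := exists_isAutonomousLagrangian hsource htime hlocal hφ hz
    have hev : muZero ε φ =ᶠ[𝓝 z]
        fun z => oneForm (z.1 • (fderiv ℝ (energy l) z.2).comp prTangent) := by
      filter_upwards [(h.isOpen.preimage prBase.continuous).mem_nhds hxU] with y hy
      exact h.muZero_eq hy
    refine ContDiffAt.congr_of_eventuallyEq (contDiffAt_oneForm ?_) hev
    have h1 : ContDiffAt ℝ ∞ (fun z : RT1Coord => fderiv ℝ (energy l) z.2) z :=
      (contDiffAt_fderiv (contDiffAt_energy (h.contDiffAt z.2 hxU))).comp z contDiffAt_snd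
    exact contDiffAt_fst.smul (h1.clm_comp contDiffAt_const)
  · obtain ⟨U, U', l, hxU, hxU', h', h⟩ := exists_compatible_isAutonomousLagrangian hsource htime
      hlocal hφ hφ' ⟨hz, hz'⟩
    have hΦ := contDiffAt_transition hφ hφ' hz hz'
    rw [h.muZero_eq hxU, h'.muZero_eq (z := jet1.lift (φ' ∘ φ.symm) z) hxU',
      oneForm_compContinuousLinearMap]
    have hl := h'.contDiffAt (tangent.lift (φ' ∘ φ.symm) z.2) hxU'
    have hΦ2 : ∀ᶠ y : TCoord in 𝓝 z.2, ContDiffAt ℝ 2 (φ' ∘ φ.symm) y.1 :=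
      (continuous_fst.continuousAt : Filter.Tendsto Prod.fst (𝓝 z.2) (𝓝 z.2.1)).eventually
        (eventually_contDiffAt_two hΦ)
    have hT := contDiffAt_tangent_lift (z := z.2) hΦ
    -- The equality of energies is needed near the point, because `μ₀` involves their differentials.
    have hev : energy (l ∘ tangent.lift (φ' ∘ φ.symm)) =ᶠ[𝓝 z.2]
        energy l ∘ tangent.lift (φ' ∘ φ.symm) := by
      filter_upwards [hΦ2, hT.continuousAt.eventually (eventually_contDiffAt_two hl)] with y hy hy'
      exact energy_comp_lift hy (hy'.differentiableAt (by simp))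
    rw [hev.fderiv_eq, fderiv_comp z.2 (differentiableAt_of_contDiffAt (contDiffAt_energy hl))
      (differentiableAt_of_contDiffAt hT)]
    congr 1
    refine ContinuousLinearMap.ext fun u => ?_
    change z.1 * fderiv ℝ (energy l) _ (fderiv ℝ (tangent.lift (φ' ∘ φ.symm)) z.2 u.2) =
      z.1 * fderiv ℝ (energy l) _ (fderiv ℝ (jet1.lift (φ' ∘ φ.symm)) z u).2
    rw [fderiv_jet1_lift hΦ]
    rfl

theorem isForm_kappa (hsource : IsSourceForm ε) (htime : IsTimeIndependent ε)
    (hlocal : IsLocallyVariational ε) : IsForm tangent (kappa ε) := by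
  refine ⟨fun φ hφ z hz => ContDiffAt.contDiffWithinAt ?_, fun φ hφ φ' hφ' z hz hz' => ?_⟩
  · obtain ⟨U, l, hxU, h⟩ := exists_isAutonomousLagrangian hsource htime hlocal hφ hz
    have hev : kappa ε φ =ᶠ[𝓝 z] fun z => oneForm ((momentum l z - zeroMomentum l z.1).comp
        (ContinuousLinearMap.fst ℝ Plane Plane)) := by
      filter_upwards [h.eventually_mem hxU] with y hy
      exact h.kappa_eq hy
    refine ContDiffAt.congr_of_eventuallyEq (contDiffAt_oneForm ?_) hev
    have h1 : ContDiffAt ℝ ∞ (fun z : TCoord => zeroMomentum l z.1) z :=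
      (contDiffAt_zeroMomentum (h.contDiffAt (z.1, 0) hxU)).comp z contDiffAt_fst
    exact ((contDiffAt_momentum (h.contDiffAt z hxU)).sub h1).clm_comp contDiffAt_const
  · obtain ⟨U, U', l, hxU, hxU', h', h⟩ := exists_compatible_isAutonomousLagrangian hsource htime
      hlocal hφ hφ' ⟨hz, hz'⟩
    have hΦ := (contDiffAt_transition hφ hφ' hz hz').of_le two_le_infty
    rw [h.kappa_eq hxU, h'.kappa_eq (z := tangent.lift (φ' ∘ φ.symm) z) hxU',
      oneForm_compContinuousLinearMap,
      momentum_comp_lift hΦ (differentiableAt_of_contDiffAt (h'.contDiffAt _ hxU')),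
      zeroMomentum_comp_lift (x := z.1) hΦ (differentiableAt_of_contDiffAt (h'.contDiffAt _ hxU'))]
    congr 1
    refine ContinuousLinearMap.ext fun u => ?_
    simp only [ContinuousLinearMap.comp_apply, sub_apply]
    rw [fderiv_tangent_lift hΦ]
    rfl

theorem isForm_omega (hsource : IsSourceForm ε) (htime : IsTimeIndependent ε)
    (hlocal : IsLocallyVariational ε) : IsForm base (omega ε) := by
  refine ⟨fun φ hφ x hx => ContDiffAt.contDiffWithinAt ?_, fun φ hφ φ' hφ' x hx hx' => ?_⟩
  · obtain ⟨U, l, hxU, h⟩ := exists_isAutonomousLagrangian hsource htime hlocal hφ hx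
    have hl := h.contDiffAt (x, 0) hxU
    have hev : (fun y => coeffC ε φ (y, 0)) =ᶠ[𝓝 x] fun y =>
        fderiv ℝ (fderiv ℝ l) (y, 0) (e 0, 0) (0, e 1)
          - fderiv ℝ (fderiv ℝ l) (y, 0) (e 1, 0) (0, e 0) := by
      filter_upwards [h.isOpen.mem_nhds hxU] with y hy
      exact h.coeffC_eq (z := (y, 0)) hy
    have h1 : ContDiffAt ℝ ∞ (fun y : Plane => fderiv ℝ (fderiv ℝ l) (y, 0)) x :=
      ContDiffAt.comp (g := fderiv ℝ (fderiv ℝ l)) x (contDiffAt_fderiv (contDiffAt_fderiv hl))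
        (contDiffAt_id.prodMk contDiffAt_const)
    have h2 : ∀ u w, ContDiffAt ℝ ∞ (fun y : Plane => fderiv ℝ (fderiv ℝ l) (y, 0) u w) x :=
      fun u w => (h1.clm_apply contDiffAt_const).clm_apply contDiffAt_const
    exact (((h2 _ _).sub (h2 _ _)).congr_of_eventuallyEq hev).smul contDiffAt_const
  · obtain ⟨U, U', l, hxU, hxU', h', h⟩ := exists_compatible_isAutonomousLagrangian hsource htime
      hlocal hφ hφ' ⟨hx, hx'⟩
    have hΦ := contDiffAt_transition hφ hφ' hx hx'
    have hl := h'.contDiffAt ((φ' ∘ φ.symm) x, 0) hxU'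
    have hinl : ContinuousAt (fun y : Plane => (((φ' ∘ φ.symm) y, 0) : TCoord)) x :=
      hΦ.continuousAt.prodMk continuousAt_const
    have hev : (fun y => oneForm (zeroMomentum (l ∘ tangent.lift (φ' ∘ φ.symm)) y)) =ᶠ[𝓝 x]
        fun y => (oneForm (zeroMomentum l ((φ' ∘ φ.symm) y))).compContinuousLinearMap
          (fderiv ℝ (φ' ∘ φ.symm) y) := by
      filter_upwards [eventually_contDiffAt_two hΦ,
        hinl.eventually (eventually_contDiffAt_two hl)] with y hy hy'
      rw [zeroMomentum_comp_lift hy (hy'.differentiableAt (by simp)),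
        oneForm_compContinuousLinearMap]
    have hd : DifferentiableAt ℝ (fun y => oneForm (zeroMomentum l y)) ((φ' ∘ φ.symm) x) :=
      differentiableAt_of_contDiffAt (contDiffAt_oneForm (contDiffAt_zeroMomentum hl))
    rw [h.omega_eq (x := x) hxU, hev.extDeriv_eq]
    -- The 1-forms `θ` of the two charts are pull-backs of each other near `x`, and the exterior
    -- derivative commutes with pull-back.
    refine (extDeriv_pullback (r := ∞) hd hΦ (by simpa using two_le_infty)).trans ?_
    rw [← h'.omega_eq (x := (φ' ∘ φ.symm) x) hxU']
    rfl

theorem isLagrangian1_firstOrderLagrangian (hsource : IsSourceForm ε) (htime : IsTimeIndependent ε)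
    (hlocal : IsLocallyVariational ε) (hη : IsForm base η) :
    IsLagrangian1 (firstOrderLagrangian ε η) := by
  refine ⟨⟨fun φ hφ z hz => ContDiffAt.contDiffWithinAt ?_, fun φ hφ φ' hφ' z hz hz' => ?_⟩,
    fun φ _ z _ => ?_⟩
  · obtain ⟨U, l, hxU, h⟩ := exists_isAutonomousLagrangian hsource htime hlocal hφ hz
    have hev : firstOrderFunction ε η φ =ᶠ[𝓝 z]
        reducedFunction l (fun x => covector (η φ x)) := by
      filter_upwards [(h.isOpen.preimage prBase.continuous).mem_nhds hxU] with y hy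
      exact h.firstOrderFunction_eq hy
    have hβ : ContDiffAt ℝ ∞ (fun y => covector (η φ y)) z.2.1 :=
      (covector (X := Plane)).contDiff.contDiffAt.comp z.2.1 (hη.contDiffAt_base hφ hz)
    exact ((contDiffAt_reducedFunction (h.contDiffAt _ hxU) (h.contDiffAt (z.2.1, 0) hxU)
      hβ).congr_of_eventuallyEq hev).smul contDiffAt_const
  · obtain ⟨U, U', l, hxU, hxU', h', h⟩ := exists_compatible_isAutonomousLagrangian hsource htime
      hlocal hφ hφ' ⟨hz, hz'⟩
    have hΦ := contDiffAt_transition hφ hφ' hz hz'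
    have hβ : covector (η φ z.2.1) = (covector (η φ' ((φ' ∘ φ.symm) z.2.1))).comp
        (fderiv ℝ (φ' ∘ φ.symm) z.2.1) := by
      rw [hη.2 φ hφ φ' hφ' z.2.1 hz hz']
      rfl
    have hfun : firstOrderFunction ε η φ z =
        firstOrderFunction ε η φ' (jet1.lift (φ' ∘ φ.symm) z) := by
      rw [h.firstOrderFunction_eq hxU, h'.firstOrderFunction_eq hxU',
        ← reducedFunction_comp_lift (hΦ.of_le two_le_infty)
          (differentiableAt_of_contDiffAt (h'.contDiffAt (_, 0) hxU'))]
      simp only [reducedFunction]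
      rw [hβ]
    ext u
    change firstOrderFunction ε η φ z * (u 0).1 = firstOrderFunction ε η φ' _ *
      (fderiv ℝ (jet1.lift (φ' ∘ φ.symm)) z (u 0)).1
    rw [fderiv_jet1_lift hΦ, hfun]
  · ext u
    simp [lagrangeFunction1, firstOrderLagrangian, dt1]

end Global

end GlobalLagrangian

end

/-! ### The main theorem -/

theorem mainTheorem1 {M : Type*} [TopologicalSpace M] [T2Space M] [SecondCountableTopology M]
    [ConnectedSpace M] [ChartedSpace GlobalLagrangian.Plane M] [IsManifold (𝓡 2) ∞ M]
    (hH : GlobalLagrangian.DeRhamH2Trivial M)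
    (ε : GlobalLagrangian.FormFamily M GlobalLagrangian.RT2Coord 2)
    (hsource : GlobalLagrangian.IsSourceForm ε)
    (htime : GlobalLagrangian.IsTimeIndependent ε)
    (hlocal : GlobalLagrangian.IsLocallyVariational ε) :
    GlobalLagrangian.IsGloballyVariational ε ∧
    GlobalLagrangian.IsAffineInAcceleration ε ∧
    GlobalLagrangian.IsForm GlobalLagrangian.jet1 (GlobalLagrangian.muZero ε) ∧
    GlobalLagrangian.IsForm GlobalLagrangian.tangent (GlobalLagrangian.kappa ε) ∧
    GlobalLagrangian.IsForm GlobalLagrangian.base (GlobalLagrangian.omega ε) ∧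
    (∃ η : GlobalLagrangian.FormFamily M GlobalLagrangian.Plane 1,
      GlobalLagrangian.IsForm GlobalLagrangian.base η ∧
      GlobalLagrangian.EqForm GlobalLagrangian.base (GlobalLagrangian.d η)
        (GlobalLagrangian.omega ε)) ∧
    ∀ η : GlobalLagrangian.FormFamily M GlobalLagrangian.Plane 1,
      GlobalLagrangian.IsForm GlobalLagrangian.base η →
      GlobalLagrangian.EqForm GlobalLagrangian.base (GlobalLagrangian.d η)
        (GlobalLagrangian.omega ε) →
      GlobalLagrangian.IsLagrangian2 (GlobalLagrangian.globalLagrangian ε η) ∧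
      GlobalLagrangian.IsEulerLagrangeForm2 ε (GlobalLagrangian.globalLagrangian ε η) := by
  open GlobalLagrangian in
  have hω : IsForm base (omega ε) := isForm_omega hsource htime hlocal
  open GlobalLagrangian in
  have hEL : ∀ η : FormFamily M Plane 1, IsForm base η → EqForm base (d η) (omega ε) →
      IsEulerLagrangeForm1 ε (firstOrderLagrangian ε η) ∧
        IsEulerLagrangeForm2 ε (globalLagrangian ε η) := by
    intro η hη hdη
    constructor
    · intro φ hφ i t x v a hx
      obtain ⟨U, l, hxU, h⟩ := exists_isAutonomousLagrangian hsource htime hlocal hφ hx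
      have hL : lagrangeFunction1 (firstOrderLagrangian ε η) φ = firstOrderFunction ε η φ := by
        funext z
        exact mul_one _
      rw [hL, h.eulerLagrange1_firstOrderFunction hxU (hη.contDiffAt_base hφ hx) (hdη φ hφ x hx)]
    · intro φ hφ i t x v a b c hx
      obtain ⟨U, l, hxU, h⟩ := exists_isAutonomousLagrangian hsource htime hlocal hφ hx
      rw [h.eulerLagrange2_globalLagrangian hxU (hη.contDiffAt_base hφ hx) (hdη φ hφ x hx)]
  open GlobalLagrangian in
  -- The only use of the hypothesis on cohomology: `ω` is closed for reasons of dimension.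
  obtain ⟨η, hη, hdη⟩ := hH (omega ε) hω (d_eqForm_zero _)
  have hμ := GlobalLagrangian.isForm_muZero hsource htime hlocal
  have hκ := GlobalLagrangian.isForm_kappa hsource htime hlocal
  refine ⟨⟨GlobalLagrangian.firstOrderLagrangian ε η,
    GlobalLagrangian.isLagrangian1_firstOrderLagrangian hsource htime hlocal hη,
    (hEL η hη hdη).1⟩, ?_, hμ, hκ, hω, ⟨η, hη, hdη⟩, fun η hη hdη =>
      ⟨GlobalLagrangian.isLagrangian2_horizontalization
        ((hμ.add hκ.pullback_prTangent).add hη.pullback_prBase), (hEL η hη hdη).2⟩⟩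
  intro φ hφ i t x v a hx
  obtain ⟨U, l, hxU, h⟩ :=
    GlobalLagrangian.exists_isAutonomousLagrangian hsource htime hlocal hφ hx
  exact h.coeff_affine hxU i t v a
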